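/- **Setting.** Let $k=\mathbb R$ or $k=\mathbb C$. For $f\in\mathcal S(\mathbb R)=\mathcal S(\mathbb R;k)$ put $$\lambda(p)=p+\mathrm{p.v.}\!\!\int \frac{f(q)}{p-q}\,dq$$ ($\mathrm{p.v.}\!\!\int$ denotes the principal value), and let $f'=df/dp$. Let $h:k\to k$ be smooth (entire if $k=\mathbb C$) with $h(0)=0$ (so that the integrals below converge), and put, for $n\in\mathbb N=\{0,1,2,\dots\}$, $$H_{h,n}[f]=\frac1{n!}\int h(f(p))\,\lambda(p)^n\,dp .$$ The variational derivative $\delta F/\delta f$ of a functional $F$ is the tempered distribution defined by $\langle \delta F/\delta f,\Phi\rangle=\frac{d}{d\epsilon}\big|_{\epsilon=0}F[f+\epsilon\Phi]$ for all Schwartz functions $\Phi$. Let $\mathcal O_M$ be the space of smooth functions that have, together with all their derivatives, at most polynomial growth. Consider the metric $\eta^{(p,q)}=-f'(p)\,\delta(p-q)$, which sends $\theta\in\mathcal O_M(\mathbb R)$ to the vector $X=-f'\theta$. For a vector field of this form its covariant derivative is $$\nabla_{(q)}X^{(p)}=\frac{\delta X^{(p)}}{\delta f(q)}+\int\Gamma\tbinom{p}{q\,r}X^{(r)}dr,\qquad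 \Gamma\tbinom{p}{q\,r}=\frac{1}{f'(q)}\,\delta'(q-p)\,\delta(q-r),$$ and the product is given by the structure constants $$c\tbinom{p}{q\,r}=\frac{\delta(p-r)}{p-q}-\frac{f'(p)}{f'(q)}\frac{\delta(q-r)}{p-q}+\frac{\delta(p-q)}{q-r}-\frac{\lambda'(p)}{f'(p)}\,\delta(q-r)\,\delta(q-p).$$ In both formulas the quotient $X/f'$ is read as $-\theta$. For $f\in\mathcal S(\mathbb R^2)$, a function of $(x,p)$, the above is applied to $f(x,\cdot)$ for each fixed $x$. Let $\{u,v\}_{x,p}=u_pv_x-u_xv_p$, and let $$\{\mathcal G,\mathcal H\}_{LP}=\iint f\,\Big\{\frac{\delta\mathcal G}{\delta f},\frac{\delta\mathcal H}{\delta f}\Big\}_{x,p}\,dp\,dx$$ be the Lie–Poisson (Poisson–Vlasov) bracket, where $\delta\mathcal H/\delta f\in\mathcal O_M(\mathbb R^2)$, while $\delta\mathcal G/\delta f$ may be any tempered distribution (for example a delta function, for $\mathcal G=f(x,p)$). **Theorem.** The functional $H_{h,n}$ is given by a convergent integral and has at every $f\in\mathcal S(\mathbb R)$ a variational derivative in $\mathcal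 O_M(\mathbb R)$, so that the vector fields $X_{h,n}^{(p)}=\int\frac{\delta H_{h,n}}{\delta f(q)}\eta^{(q,p)}dq=-f'(p)\frac{\delta H_{h,n}}{\delta f(p)}$ are defined. Explicitly, $$X^{(p)}_{h,n}=\Big(\frac{1}{(n-1)!}\mathrm{p.v.}\!\!\int\frac{h(f(q))\lambda(q)^{n-1}}{p-q}dq-\frac1{n!}h'(f(p))\lambda(p)^n\Big)f'(p),$$ the first term being absent for $n=0$. They satisfy the recursion relations of the principal hierarchy $$\nabla_{(q)}X^{(p)}_{h,n+1}=\int c\tbinom{p}{q\,r}X^{(r)}_{h,n}\,dr,\qquad n\in\mathbb N,$$ as an identity between tempered distributions in $q$, for every $f\in\mathcal S(\mathbb R)$ and every $p\in\mathbb R$. Moreover, on $\mathcal S(\mathbb R^2)$ the corresponding flows $$\partial_{t_{h,n}}f(p)=\int V_{h,n}\tbinom{p}{q}f_x(q)\,dq,\qquad V_{h,n}\tbinom{p}{q}=\int c\tbinom{p}{q\,r}X_{h,n}^{(r)}\,dr,$$ are Hamiltonian with respect to the Lie–Poisson bracket: the right-hand side equals $\{f(x,p),\mathcal H_{h,n+1}\}_{LP}$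 at every $(x,p)$, where $\mathcal H_{h,n+1}=\int H_{h,n+1}\,dx$ is a convergent integral. These flows commute pairwise: for all $h,g$ as above and all $n,m\in\mathbb N$, the right-hand sides of $\partial_{t_{h,n}}f$ and $\partial_{t_{g,m}}f$ lie in $\mathcal S(\mathbb R^2)$, and $\partial_{t_{g,m}}\partial_{t_{h,n}}f=\partial_{t_{h,n}}\partial_{t_{g,m}}f$ holds at every $f\in\mathcal S(\mathbb R^2)$, where the derivatives are taken along these right-hand sides. -/

import Mathlib

open MeasureTheory Filter Topology SchwartzMap LineDeriv
open scoped ContDiff Nat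

namespace DKP

noncomputable section

/-! ### Principal values and the function `λ` -/

/-- The Cauchy principal value `⨍ u(q) / (p - q) dq`. -/
def pv {𝕜 : Type*} [RCLike 𝕜] (u : ℝ → 𝕜) (p : ℝ) : 𝕜 :=
  limUnder (𝓝[>] (0 : ℝ)) fun ε : ℝ => ∫ q in {q : ℝ | ε < |p - q|}, u q / ((p - q : ℝ) : 𝕜)

/-- `λ(p) = p + ⨍ f(q) / (p - q) dq`. -/
def lam {𝕜 : Type*} [RCLike 𝕜] (f : 𝓢(ℝ, 𝕜)) (p : ℝ) : 𝕜 :=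
  (p : 𝕜) + pv f p

/-! ### Variational derivatives -/

section Variational

variable {𝕜 : Type*} [RCLike 𝕜] {E : Type*} [NormedAddCommGroup E] [NormedSpace ℝ E]

/-- The tempered distribution `T` is the variational derivative of the functional `F` at `f`:
`⟨T, Φ⟩ = d/dε F[f + ε Φ]` at `ε = 0`, for every Schwartz function `Φ`. -/
def HasVarDeriv (F : 𝓢(E, 𝕜) → 𝕜) (f : 𝓢(E, 𝕜)) (T : 𝓢(E, 𝕜) →L[𝕜] 𝕜) : Prop :=
  ∀ Φ : 𝓢(E, 𝕜), HasDerivAt (fun ε : 𝕜 => F (f + ε • Φ)) (T Φ) 0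

/-- The function `k`, smooth and with all derivatives of polynomial growth (that is, `k ∈ 𝓞_M`),
is the variational derivative `δF/δf` of the functional `F` at `f`:
`∫ k Φ = d/dε F[f + ε Φ]` at `ε = 0`, for every Schwartz function `Φ`. -/
def HasVarDensity [MeasureSpace E] (F : 𝓢(E, 𝕜) → 𝕜) (f : 𝓢(E, 𝕜)) (k : E → 𝕜) : Prop :=
  k.HasTemperateGrowth ∧
    ∀ Φ : 𝓢(E, 𝕜), HasDerivAt (fun ε : 𝕜 => F (f + ε • Φ)) (∫ z, k z * Φ z) 0

/-- The variational derivative in `𝓞_M` is unique. -/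
theorem HasVarDensity.unique [MeasureSpace E] [BorelSpace E] [FiniteDimensional ℝ E]
    [(volume : Measure E).IsOpenPosMeasure] [IsLocallyFiniteMeasure (volume : Measure E)]
    {F : 𝓢(E, 𝕜) → 𝕜} {f : 𝓢(E, 𝕜)} {k l : E → 𝕜}
    (hk : HasVarDensity F f k) (hl : HasVarDensity F f l) : k = l := by
  have ck := hk.1.1.continuous
  have cl := hl.1.1.continuous
  have key : ∀ᵐ x ∂(volume : Measure E), (k - l) x = 0 := by
    apply ae_eq_zero_of_integral_contDiff_smul_eq_zero (ck.sub cl).locallyIntegrable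
    intro g hg hc
    have hc' : HasCompactSupport (fun x => (g x : 𝕜)) := hc.comp_left (g := fun r : ℝ => (r : 𝕜))
      (by simp)
    have hg' : ContDiff ℝ ∞ (fun x => (g x : 𝕜)) := (RCLike.ofRealCLM (K := 𝕜)).contDiff.comp hg
    have h := (hk.2 (hc'.toSchwartzMap hg')).unique (hl.2 (hc'.toSchwartzMap hg'))
    have e : ∀ (m : E → 𝕜), Continuous m →
        Integrable (fun x => m x * (hc'.toSchwartzMap hg') x) volume := by
      intro m hm
      apply Continuous.integrable_of_hasCompactSupport
      · exact hm.mul (hc'.toSchwartzMap hg').continuous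
      · exact HasCompactSupport.mul_left (f := m) (f' := fun x => (g x : 𝕜)) hc'
    have h2 := integral_sub (e k ck) (e l cl)
    rw [h, sub_self] at h2
    rw [← h2]
    refine integral_congr_ae (Eventually.of_forall fun x => ?_)
    change g x • (k x - l x) = k x * (g x : 𝕜) - l x * (g x : 𝕜)
    rw [RCLike.real_smul_eq_coe_mul]
    ring
  exact (Continuous.ae_eq_iff_eq volume ck cl).1
    (key.mono fun x hx => sub_eq_zero.1 (by simpa using hx))

/-- The variational derivative `δF/δf` as a function; meaningful when some `k` satisfies
`HasVarDensity F f k`, and then it is this `k`. -/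
def varDeriv [MeasureSpace E] (F : 𝓢(E, 𝕜) → 𝕜) (f : 𝓢(E, 𝕜)) : E → 𝕜 :=
  Classical.epsilon (HasVarDensity F f)

end Variational

/-! ### The first metric, its connection, and the product

A covector at `f` is a function `θ ∈ 𝓞_M(ℝ)`. The tangent vectors in question are the functions
`X = -f' θ` obtained from covectors with the contravariant metric
`η^{(p,q)} = -f'(p) δ(p-q)`. For such an `X` the quotient `X / f'`, which enters the connection and
the structure constants, is `-θ` (also where `f'` vanishes). -/

section Geometry

variable {𝕜 : Type*} [RCLike 𝕜]

/-- `X^{(p)} = ∫ θ(q) η^{(q,p)} dq = -f'(p) θ(p)`. -/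
def raise (f : 𝓢(ℝ, 𝕜)) (θ : ℝ → 𝕜) (p : ℝ) : 𝕜 :=
  -(deriv f p) * θ p

/-- The Christoffel term `∬ Γ(p; q, r) X^{(r)} Φ(q) dr dq` with
`Γ(p; q, r) = δ'(q-p) δ(q-r) / f'(q)` and `X = -f' θ`. Since `∫ δ'(q-p) u(q) dq = -u'(p)`, it is
`-(d/dp) ((X/f') Φ) = (θ Φ)'(p)`. -/
def christoffelTerm (θ : ℝ → 𝕜) (Φ : 𝓢(ℝ, 𝕜)) (p : ℝ) : 𝕜 :=
  -deriv (fun q => -θ q * Φ q) p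

/-- `T`, a tempered distribution in the variable `q`, is the covariant derivative
`∇_{(q)} X^{(p)} = δX^{(p)}/δf(q) + ∫ Γ(p; q, r) X^{(r)} dr`, at the point `f`, of the vector
field `g ↦ X[g] = -g' θ[g]`. -/
def HasCovDeriv (θ : 𝓢(ℝ, 𝕜) → ℝ → 𝕜) (f : 𝓢(ℝ, 𝕜)) (p : ℝ) (T : 𝓢(ℝ, 𝕜) →L[𝕜] 𝕜) : Prop :=
  ∃ D : 𝓢(ℝ, 𝕜) →L[𝕜] 𝕜, HasVarDeriv (fun g => raise g (θ g) p) f D ∧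
    ∀ Φ : 𝓢(ℝ, 𝕜), T Φ = D Φ + christoffelTerm (θ f) Φ p

/-- The operator `V_X(p, q) = ∫ c(p; q, r) X^{(r)} dr` of multiplication by `X = -f' θ`, applied to
`Φ`: the value at `p` of `∬ c(p; q, r) X^{(r)} Φ(q) dr dq`, where
`c(p; q, r) = δ(p-r)/(p-q) - (f'(p)/f'(q)) δ(q-r)/(p-q) + δ(p-q)/(q-r)
  - (λ'(p)/f'(p)) δ(q-r) δ(q-p)`. The four summands below are those of `c`, in this order. -/
def mulOp (f : 𝓢(ℝ, 𝕜)) (θ : ℝ → 𝕜) (Φ : 𝓢(ℝ, 𝕜)) (p : ℝ) : 𝕜 :=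
  raise f θ p * pv Φ p
    - deriv f p * pv (fun q => -θ q * Φ q) p
    + Φ p * pv (raise f θ) p
    - deriv (lam f) p * -θ p * Φ p

/-! ### The principal hierarchy -/

/-- `H_{h,n}[f] = (1/n!) ∫ h(f(p)) λ(p)^n dp`. -/
def H (h : 𝕜 → 𝕜) (n : ℕ) (f : 𝓢(ℝ, 𝕜)) : 𝕜 :=
  (1 / (n ! : 𝕜)) * ∫ p, h (f p) * lam f p ^ n

/-- The covector field `δH_{h,n}/δf`. -/
def dH (h : 𝕜 → 𝕜) (n : ℕ) (f : 𝓢(ℝ, 𝕜)) : ℝ → 𝕜 :=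
  varDeriv (H h n) f

/-- The vector field `X_{h,n} = ∫ δH_{h,n}/δf(q) η^{(q,p)} dq = -f' δH_{h,n}/δf`. -/
def X (h : 𝕜 → 𝕜) (n : ℕ) (f : 𝓢(ℝ, 𝕜)) : ℝ → 𝕜 :=
  raise f (dH h n f)

/-- `V_{h,n}(p, q) = ∫ c(p; q, r) X_{h,n}^{(r)} dr`, applied to `Φ`. -/
def V (h : 𝕜 → 𝕜) (n : ℕ) (f Φ : 𝓢(ℝ, 𝕜)) : ℝ → 𝕜 :=
  mulOp f (dH h n f) Φ

end Geometry

/-! ### Functions of `(x, p)`, the flows, and the Lie-Poisson bracket -/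

section Plane

variable {𝕜 : Type*} [RCLike 𝕜]

theorem hasTemperateGrowth_mk (x : ℝ) :
    (fun p : ℝ => ((x, p) : ℝ × ℝ)).HasTemperateGrowth := by
  have h : (fun p : ℝ => ((x, p) : ℝ × ℝ))
      = (fun p : ℝ => ContinuousLinearMap.inr ℝ ℝ ℝ p + ((x, 0) : ℝ × ℝ)) := by
    ext p <;> simp
  rw [h]
  exact (ContinuousLinearMap.inr ℝ ℝ ℝ).hasTemperateGrowth.add
    (Function.HasTemperateGrowth.const _)

theorem norm_le_mk (x : ℝ) :
    ∃ (k : ℕ) (C : ℝ), ∀ p : ℝ, ‖p‖ ≤ C * (1 + ‖((x, p) : ℝ × ℝ)‖) ^ k :=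
  ⟨1, 1, fun p => by
    have : ‖p‖ ≤ ‖((x, p) : ℝ × ℝ)‖ := norm_snd_le ((x, p) : ℝ × ℝ)
    rw [pow_one, one_mul]
    linarith⟩

/-- The Schwartz function `p ↦ f(x, p)`, for fixed `x`. -/
def slice (f : 𝓢(ℝ × ℝ, 𝕜)) (x : ℝ) : 𝓢(ℝ, 𝕜) :=
  SchwartzMap.compCLM 𝕜 (hasTemperateGrowth_mk x) (norm_le_mk x) f

/-- The right-hand side `∫ V_{h,n}(p, q) f_x(q) dq` of the flow `∂f/∂t_{h,n}`, at the point
`z = (x, p)`. -/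
def flow (h : 𝕜 → 𝕜) (n : ℕ) (f : 𝓢(ℝ × ℝ, 𝕜)) (z : ℝ × ℝ) : 𝕜 :=
  V h n (slice f z.1) (slice (∂_{((1, 0) : ℝ × ℝ)} f) z.1) z.2

/-- `𝓗_{h,n}[f] = ∫ H_{h,n}[f(x, ·)] dx`. -/
def totalH (h : 𝕜 → 𝕜) (n : ℕ) (f : 𝓢(ℝ × ℝ, 𝕜)) : 𝕜 :=
  ∫ x, H h n (slice f x)

/-- The pairing `⟨f, {T, k}_{x,p}⟩` of `f` with the canonical bracket
`{T, k}_{x,p} = T_p k_x - T_x k_p` of a tempered distribution `T` and a function `k ∈ 𝓞_M`; the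
derivatives of `T` and its products with functions are those of tempered distributions, so that
`⟨f, T_p k_x⟩ = -⟨T, ∂_p (k_x f)⟩` and `⟨f, T_x k_p⟩ = -⟨T, ∂_x (k_p f)⟩`. -/
def bracketPairing (f : 𝓢(ℝ × ℝ, 𝕜)) (T : 𝓢(ℝ × ℝ, 𝕜) →L[𝕜] 𝕜) (k : ℝ × ℝ → 𝕜) : 𝕜 :=
  -T (∂_{((0, 1) : ℝ × ℝ)} (smulLeftCLM 𝕜 (fun z => fderiv ℝ k z (1, 0)) f))
    - -T (∂_{((1, 0) : ℝ × ℝ)} (smulLeftCLM 𝕜 (fun z => fderiv ℝ k z (0, 1)) f))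

/-- At `f`, the Lie-Poisson (Poisson-Vlasov) bracket
`{𝒢, 𝓗}_{LP} = ∬ f {δ𝒢/δf, δ𝓗/δf}_{x,p} dp dx` is defined and equal to `v`. Here `δ𝓗/δf` is a
function in `𝓞_M`, while `δ𝒢/δf` may be any tempered distribution, so that `𝒢 = f(x, p)`, with
`δ𝒢/δf` a delta function, is allowed. -/
def HasLPBracket (f : 𝓢(ℝ × ℝ, 𝕜)) (𝒢 ℋ : 𝓢(ℝ × ℝ, 𝕜) → 𝕜) (v : 𝕜) : Prop :=
  ∃ (T : 𝓢(ℝ × ℝ, 𝕜) →L[𝕜] 𝕜) (k : ℝ × ℝ → 𝕜),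
    HasVarDeriv 𝒢 f T ∧ HasVarDensity ℋ f k ∧ v = bracketPairing f T k

/-- The evolution equations `f_t = A[f]` and `f_s = B[f]` are compatible at `f`:
`A[f]` and `B[f]` are Schwartz functions, and the derivative of `A` at `f` in the direction `B[f]`
exists and equals the derivative of `B` at `f` in the direction `A[f]`
(that is, `∂_s ∂_t f = ∂_t ∂_s f`). -/
def CommuteAt (A B : 𝓢(ℝ × ℝ, 𝕜) → ℝ × ℝ → 𝕜) (f : 𝓢(ℝ × ℝ, 𝕜)) : Prop :=
  ∃ a b : 𝓢(ℝ × ℝ, 𝕜), ⇑a = A f ∧ ⇑b = B f ∧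
    ∀ z : ℝ × ℝ, ∃ v : 𝕜, HasDerivAt (fun ε : 𝕜 => A (f + ε • b) z) v 0 ∧
      HasDerivAt (fun ε : 𝕜 => B (f + ε • a) z) v 0

end Plane

end

end DKP

/-! Write P u(p) = ⨍ u(q)/(p-q) dq (`lineHilbert`), so that λ = p + Pf. Put a = h(f)λⁿ/n!
(`density`), α = h'(f)λⁿ/n! and β = ∂a/∂λ (`densityLam`); then the variation of a along Φ is αΦ + β
PΦ. Two properties of P carry the theorem: antisymmetry, ∫ u Pv = -∫ v Pu
(`integral_mul_lineHilbert`), and the product formula Pu Pv = P(u Pv) + P(v Pu) + c uv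
(`exists_lineHilbert_mul_lineHilbert`). The constant c is never evaluated, because it always
cancels.

Antisymmetry gives δH/δf = α - Pβ (`covector`). Since ∂/∂λ lowers n by one, β at level n+1 is a at
level n; this is the source of the recursion. In the covariant derivative of X at level n+1, the
Christoffel term cancels the Φ' that comes from varying the factor f'. In the multiplication
operator at level n, the product formula for the pairs (β, Φ) and (β, f') removes all products of
principal values. Both sides become α(λ'Φ - f' PΦ) - Φ (Pa)' + f' P(αΦ + β PΦ).

For Φ = f_x one has PΦ = λ_x and αΦ + β PΦ = a_x, so the flow is f_t = α{λ,f} - {Pa,f}. This is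
{k,f} for k = δH/δf at level n+1, because the gradient of k consists of a multiple of that of f, of
α∇λ and of -∇(Pa).

For commutation, the product formula is differentiated into P({Pu,v} + {u,Pv}) = {Pu,Pv} - c{u,v}.
It gives λ_t = cβ{λ,f} - {Pa,λ}. If a and b are the densities of two flows, it also gives a closed
form for the difference of the crossed variations of Pa and Pb, the only nonlocal quantities left.
Equality of the mixed derivatives is then a polynomial identity in the derivatives of f, λ, Pa and
Pb up to second order. -/

namespace DKP

noncomputable section

/-! ### Schwartz functions as a predicate -/

section IsSchwartz

variable {E F : Type*} [NormedAddCommGroup E] [NormedSpace ℝ E] [NormedAddCommGroup F]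
  [NormedSpace ℝ F]

/-- `u` is (the underlying function of) a Schwartz function. -/
def IsSchwartz (u : E → F) : Prop := ∃ U : 𝓢(E, F), ⇑U = u

theorem isSchwartz (u : 𝓢(E, F)) : IsSchwartz (u : E → F) := ⟨u, rfl⟩

namespace IsSchwartz

variable {u v : E → F}

theorem hasTemperateGrowth (hu : IsSchwartz u) : u.HasTemperateGrowth := by
  obtain ⟨U, rfl⟩ := hu
  exact U.hasTemperateGrowth

theorem contDiff (hu : IsSchwartz u) : ContDiff ℝ ∞ u := hu.hasTemperateGrowth.1

theorem differentiable (hu : IsSchwartz u) : Differentiable ℝ u :=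
  hu.contDiff.differentiable (by simp)

theorem continuous (hu : IsSchwartz u) : Continuous u := hu.contDiff.continuous

theorem add (hu : IsSchwartz u) (hv : IsSchwartz v) : IsSchwartz (fun z => u z + v z) := by
  obtain ⟨U, rfl⟩ := hu
  obtain ⟨V, rfl⟩ := hv
  exact ⟨U + V, rfl⟩

theorem sub (hu : IsSchwartz u) (hv : IsSchwartz v) : IsSchwartz (fun z => u z - v z) := by
  obtain ⟨U, rfl⟩ := hu
  obtain ⟨V, rfl⟩ := hv
  exact ⟨U - V, rfl⟩

theorem neg (hu : IsSchwartz u) : IsSchwartz (fun z => -u z) := by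
  obtain ⟨U, rfl⟩ := hu
  exact ⟨-U, rfl⟩

theorem fderiv (hu : IsSchwartz u) : IsSchwartz (fderiv ℝ u) := by
  obtain ⟨U, rfl⟩ := hu
  exact ⟨fderivCLM ℝ E F U, rfl⟩

theorem fderiv_apply (hu : IsSchwartz u) (d : E) : IsSchwartz (fun z => _root_.fderiv ℝ u z d) := by
  obtain ⟨U, rfl⟩ := hu
  exact ⟨∂_{d} U, by ext z; exact lineDerivOp_apply_eq_fderiv d U z⟩

theorem integrable [MeasurableSpace E] [BorelSpace E] [SecondCountableTopology E]
    {μ : Measure E} [μ.HasTemperateGrowth] (hu : IsSchwartz u) : Integrable u μ := by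
  obtain ⟨U, rfl⟩ := hu
  exact U.integrable

theorem smul {𝕜 : Type*} [RCLike 𝕜] [NormedSpace 𝕜 F] {g : E → 𝕜} (hg : g.HasTemperateGrowth)
    (hu : IsSchwartz u) : IsSchwartz (fun z => g z • u z) := by
  obtain ⟨U, rfl⟩ := hu
  exact ⟨smulLeftCLM F g U, by ext z; exact smulLeftCLM_apply_apply hg U z⟩

theorem mul_left {𝕜 : Type*} [RCLike 𝕜] {g u : E → 𝕜} (hg : g.HasTemperateGrowth)
    (hu : IsSchwartz u) : IsSchwartz (fun z => g z * u z) := hu.smul hg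

theorem mul_right {𝕜 : Type*} [RCLike 𝕜] {g u : E → 𝕜} (hu : IsSchwartz u)
    (hg : g.HasTemperateGrowth) : IsSchwartz (fun z => u z * g z) := by
  simpa only [mul_comm] using hu.mul_left hg

theorem const_mul {𝕜 : Type*} [RCLike 𝕜] {u : E → 𝕜} (c : 𝕜)
    (hu : IsSchwartz u) : IsSchwartz (fun z => c * u z) := hu.mul_left (.const c)

/-- Weighted bounds of a Schwartz function. -/
theorem exists_decay (hu : IsSchwartz u) (k : ℕ) :
    ∃ C : ℝ, 0 ≤ C ∧ ∀ z, (1 + ‖z‖) ^ k * ‖u z‖ ≤ C := by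
  obtain ⟨U, rfl⟩ := hu
  refine ⟨2 ^ k * ((Finset.Iic (k, 0)).sup (schwartzSeminormFamily ℝ E F)) U, by positivity,
    fun z => ?_⟩
  have := one_add_le_sup_seminorm_apply (𝕜 := ℝ) (m := (k, 0)) le_rfl le_rfl U z
  rwa [norm_iteratedFDeriv_zero] at this

theorem exists_bound (hu : IsSchwartz u) :
    ∃ C : ℝ, 0 ≤ C ∧ (∀ z, (1 + ‖z‖) * ‖u z‖ ≤ C) ∧ ∀ z, ‖_root_.fderiv ℝ u z‖ ≤ C := by
  obtain ⟨C, hC, h⟩ := hu.exists_decay 1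
  obtain ⟨C', hC', h'⟩ := hu.fderiv.exists_decay 0
  exact ⟨max C C', le_max_of_le_left hC, fun z => le_max_of_le_left (by simpa using h z),
    fun z => le_max_of_le_right (by simpa using h' z)⟩

/-- A function with Schwartz derivative which decays rapidly is Schwartz. -/
theorem of_fderiv (hd : Differentiable ℝ u) (hf : IsSchwartz (_root_.fderiv ℝ u))
    (h : ∀ k : ℕ, ∃ C : ℝ, ∀ z, ‖z‖ ^ k * ‖u z‖ ≤ C) : IsSchwartz u := by
  obtain ⟨V, hV⟩ := hf
  refine ⟨⟨u, contDiff_infty_iff_fderiv.2 ⟨hd, hV ▸ V.smooth ⊤⟩, fun k n => ?_⟩, rfl⟩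
  rcases n with _ | n
  · simpa using h k
  · obtain ⟨C, -, hC⟩ := V.decay k n
    refine ⟨C, fun z => ?_⟩
    rw [← norm_iteratedFDeriv_fderiv, ← hV]
    exact hC z

end IsSchwartz

end IsSchwartz

/-! ### The principal value along a line -/

section LineHilbert

variable {E F : Type*} [NormedAddCommGroup E] [NormedSpace ℝ E] [NormedAddCommGroup F]
  [NormedSpace ℝ F]

/-- The principal value `⨍ u(z - s e) / s ds`, written as an absolutely convergent integral. -/
def lineHilbert (e : E) (u : E → F) (z : E) : F :=
  ∫ s in Set.Ioi (0 : ℝ), s⁻¹ • (u (z - s • e) - u (z + s • e))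

/-- For s ≤ 1 the mean value inequality absorbs the factor 1/s. For s ≥ 1 each of the points w = z ∓
s e satisfies 1 + s ≤ (1 + ‖z‖)(1 + ‖w‖), so the decay of u supplies a second power of s. The price
is linear growth in z, harmless for functions of temperate growth. This one bound serves as the
dominating function throughout. -/
theorem norm_kernel_le {e : E} (he : ‖e‖ = 1) {u : E → F} {C : ℝ} (hd : Differentiable ℝ u)
    (h1 : ∀ z, (1 + ‖z‖) * ‖u z‖ ≤ C) (h2 : ∀ z, ‖fderiv ℝ u z‖ ≤ C) (z : E) {s : ℝ}
    (hs : 0 < s) :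
    ‖s⁻¹ • (u (z - s • e) - u (z + s • e))‖ ≤ 4 * C * (1 + ‖z‖) * (1 + s ^ 2)⁻¹ := by
  have hC : 0 ≤ C := (norm_nonneg _).trans (h2 z)
  rw [norm_smul, norm_inv, Real.norm_of_nonneg hs.le, inv_mul_le_iff₀ hs, ← div_eq_mul_inv,
    mul_div_assoc', le_div_iff₀ (by positivity)]
  rcases le_total s 1 with hs1 | hs1
  · have hm : ‖u (z - s • e) - u (z + s • e)‖ ≤ C * (2 * s) := by
      refine (Convex.norm_image_sub_le_of_norm_fderiv_le (𝕜 := ℝ) (s := Set.univ)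
        (fun x _ => hd x) (fun x _ => h2 x) convex_univ (Set.mem_univ (z + s • e))
        (Set.mem_univ (z - s • e))).trans (le_of_eq ?_)
      have : z - s • e - (z + s • e) = -((2 * s) • e) := by rw [mul_smul, two_smul]; abel
      rw [this, norm_neg, norm_smul, he, mul_one, Real.norm_of_nonneg (by positivity)]
    have : 1 + s ^ 2 ≤ 2 := by nlinarith
    calc _ ≤ C * (2 * s) * 2 := by gcongr
      _ = s * (4 * C * 1) := by ring
      _ ≤ _ := by gcongr; linarith [norm_nonneg z]
  · have key : ∀ w : E, ‖z‖ + ‖w‖ ≥ s → ‖u w‖ * (1 + s) ≤ C * (1 + ‖z‖) := by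
      intro w hw
      calc ‖u w‖ * (1 + s) ≤ ‖u w‖ * ((1 + ‖z‖) * (1 + ‖w‖)) := by
            gcongr
            nlinarith [norm_nonneg z, norm_nonneg w]
        _ = ((1 + ‖w‖) * ‖u w‖) * (1 + ‖z‖) := by ring
        _ ≤ _ := by gcongr; exact h1 w
    have hse : ‖s • e‖ = s := by rw [norm_smul, he, mul_one, Real.norm_of_nonneg hs.le]
    have k1 := key (z - s • e) (by
      have := norm_sub_le z (z - s • e)
      rwa [sub_sub_cancel, hse] at this)
    have k2 := key (z + s • e) (by
      have := norm_sub_le (z + s • e) z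
      rw [add_sub_cancel_left, hse] at this
      linarith)
    have k3 := norm_sub_le (u (z - s • e)) (u (z + s • e))
    calc ‖u (z - s • e) - u (z + s • e)‖ * (1 + s ^ 2)
        ≤ (‖u (z - s • e)‖ + ‖u (z + s • e)‖) * (2 * s * (1 + s)) := by
          gcongr
          nlinarith
      _ = 2 * s * (‖u (z - s • e)‖ * (1 + s) + ‖u (z + s • e)‖ * (1 + s)) := by ring
      _ ≤ 2 * s * (C * (1 + ‖z‖) + C * (1 + ‖z‖)) := by gcongr
      _ = _ := by ring

theorem aestronglyMeasurable_kernel {u : E → F} (hu : Continuous u) (e z : E) :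
    AEStronglyMeasurable (fun s : ℝ => s⁻¹ • (u (z - s • e) - u (z + s • e)))
      (volume.restrict (Set.Ioi 0)) :=
  (measurable_inv.aestronglyMeasurable).smul
    (Continuous.aestronglyMeasurable (by fun_prop))

theorem integrable_kernel {e : E} (he : ‖e‖ = 1) {u : E → F} (hu : IsSchwartz u) (z : E) :
    IntegrableOn (fun s : ℝ => s⁻¹ • (u (z - s • e) - u (z + s • e))) (Set.Ioi 0) := by
  obtain ⟨C, -, h1, h2⟩ := hu.exists_bound
  refine Integrable.mono' ((integrable_inv_one_add_sq.restrict).const_mul (4 * C * (1 + ‖z‖)))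
    (aestronglyMeasurable_kernel hu.continuous e z) ?_
  filter_upwards [ae_restrict_mem measurableSet_Ioi] with s hs
  exact norm_kernel_le he hu.differentiable h1 h2 z hs

theorem norm_lineHilbert_le {e : E} (he : ‖e‖ = 1) {u : E → F} {C : ℝ}
    (hd : Differentiable ℝ u) (h1 : ∀ z, (1 + ‖z‖) * ‖u z‖ ≤ C)
    (h2 : ∀ z, ‖fderiv ℝ u z‖ ≤ C) (z : E) :
    ‖lineHilbert e u z‖ ≤ 4 * C * Real.pi * (1 + ‖z‖) := by
  have hC : 0 ≤ C := (norm_nonneg _).trans (h2 z)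
  have h3 : ‖lineHilbert e u z‖ ≤
      ∫ s in Set.Ioi (0 : ℝ), 4 * C * (1 + ‖z‖) * (1 + s ^ 2)⁻¹ := by
    refine norm_integral_le_of_norm_le
      ((integrable_inv_one_add_sq.restrict).const_mul (4 * C * (1 + ‖z‖))) ?_
    filter_upwards [ae_restrict_mem measurableSet_Ioi] with s hs
    exact norm_kernel_le he hd h1 h2 z hs
  refine h3.trans ?_
  rw [integral_const_mul]
  have h4 : ∫ s in Set.Ioi (0 : ℝ), (1 + s ^ 2)⁻¹ ≤ Real.pi := by
    rw [← integral_univ_inv_one_add_sq]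
    exact setIntegral_le_integral integrable_inv_one_add_sq
      (Eventually.of_forall fun s => by positivity)
  calc _ ≤ 4 * C * (1 + ‖z‖) * Real.pi := by gcongr
    _ = _ := by ring

theorem hasFDerivAt_lineHilbert {e : E} (he : ‖e‖ = 1) {u : E → F} (hu : IsSchwartz u) (z : E) :
    HasFDerivAt (lineHilbert e u) (lineHilbert e (fderiv ℝ u) z) z := by
  obtain ⟨C, hC, h1, h2⟩ := hu.fderiv.exists_bound
  refine hasFDerivAt_integral_of_dominated_of_fderiv_le (s := Metric.ball z 1)
    -- On the unit ball around z one has 1 + ‖x‖ ≤ 2 + ‖z‖.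
    (bound := fun s => 4 * C * (2 + ‖z‖) * (1 + s ^ 2)⁻¹)
    (F := fun z s => s⁻¹ • (u (z - s • e) - u (z + s • e)))
    (F' := fun z s => s⁻¹ • (fderiv ℝ u (z - s • e) - fderiv ℝ u (z + s • e)))
    (Metric.ball_mem_nhds _ one_pos)
    (Eventually.of_forall fun x => aestronglyMeasurable_kernel hu.continuous e x)
    (integrable_kernel he hu z) (aestronglyMeasurable_kernel hu.fderiv.continuous e z) ?_
    ((integrable_inv_one_add_sq.restrict).const_mul _) ?_
  · filter_upwards [ae_restrict_mem measurableSet_Ioi] with s hs x hx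
    refine (norm_kernel_le he hu.fderiv.differentiable h1 h2 x hs).trans ?_
    have := norm_sub_norm_le x z
    have h3 : ‖x - z‖ < 1 := mem_ball_iff_norm.1 hx
    have h4 : 1 + ‖x‖ ≤ 2 + ‖z‖ := by linarith
    gcongr
  · refine Eventually.of_forall fun s x _ => ?_
    refine HasFDerivAt.const_smul (HasFDerivAt.sub ?_ ?_) _
    · exact ((hu.differentiable (x - s • e)).hasFDerivAt.comp x
        ((hasFDerivAt_id x).sub_const (s • e)))
    · exact ((hu.differentiable (x + s • e)).hasFDerivAt.comp x
        ((hasFDerivAt_id x).add_const (s • e)))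

theorem fderiv_lineHilbert {e : E} (he : ‖e‖ = 1) {u : E → F} (hu : IsSchwartz u) :
    fderiv ℝ (lineHilbert e u) = lineHilbert e (fderiv ℝ u) :=
  funext fun z => (hasFDerivAt_lineHilbert he hu z).fderiv

theorem fderiv_lineHilbert_apply {e : E} (he : ‖e‖ = 1) {u : E → F} (hu : IsSchwartz u)
    [CompleteSpace F] (z d : E) :
    fderiv ℝ (lineHilbert e u) z d = lineHilbert e (fun z => fderiv ℝ u z d) z := by
  rw [fderiv_lineHilbert he hu, lineHilbert,
    ContinuousLinearMap.integral_apply (integrable_kernel he hu.fderiv z)]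
  rfl

theorem lineHilbert_add {e : E} (he : ‖e‖ = 1) {u v : E → F} (hu : IsSchwartz u)
    (hv : IsSchwartz v) (z : E) :
    lineHilbert e (fun z => u z + v z) z = lineHilbert e u z + lineHilbert e v z := by
  rw [lineHilbert, lineHilbert, lineHilbert,
    ← integral_add (integrable_kernel he hu z) (integrable_kernel he hv z)]
  refine integral_congr_ae (Eventually.of_forall fun s => ?_)
  simp only [← smul_add]
  congr 1
  abel

theorem lineHilbert_smul {𝕜 : Type*} [RCLike 𝕜] [NormedSpace 𝕜 F] [SMulCommClass ℝ 𝕜 F] (e : E)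
    (c : 𝕜) (u : E → F) (z : E) :
    lineHilbert e (fun z => c • u z) z = c • lineHilbert e u z := by
  rw [lineHilbert, lineHilbert, ← integral_smul]
  refine integral_congr_ae (Eventually.of_forall fun s => ?_)
  simp only [← smul_sub]
  rw [smul_comm]

theorem lineHilbert_const_mul {𝕜 : Type*} [RCLike 𝕜] (e : E) (c : 𝕜) (u : E → 𝕜) (z : E) :
    lineHilbert e (fun z => c * u z) z = c * lineHilbert e u z :=
  lineHilbert_smul e c u z

theorem lineHilbert_neg (e : E) (u : E → F) (z : E) :
    lineHilbert e (fun z => -u z) z = -lineHilbert e u z := by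
  simpa using lineHilbert_smul e (-1 : ℝ) u z

theorem lineHilbert_sub {e : E} (he : ‖e‖ = 1) {u v : E → F} (hu : IsSchwartz u)
    (hv : IsSchwartz v) (z : E) :
    lineHilbert e (fun z => u z - v z) z = lineHilbert e u z - lineHilbert e v z := by
  simp only [sub_eq_add_neg]
  rw [lineHilbert_add he hu hv.neg, lineHilbert_neg]

end LineHilbert

/-! ### Smoothness and temperate growth of principal values -/

section Smooth

universe w

variable {E : Type} [NormedAddCommGroup E] [NormedSpace ℝ E]

/-- The principal value commutes with `fderiv`, so each derivative is again a principal value of a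
Schwartz function, now with values in `E →L[ℝ] F`. The induction therefore ranges over all target
spaces; with `E : Type` the new target stays in the universe of `F`. -/
theorem lineHilbert_temperate_aux {e : E} (he : ‖e‖ = 1) (n : ℕ) :
    ∀ {F : Type w} [NormedAddCommGroup F] [NormedSpace ℝ F] {u : E → F}, IsSchwartz u →
      ContDiff ℝ n (lineHilbert e u) ∧
        ∃ (k : ℕ) (C : ℝ), ∀ x, ‖iteratedFDeriv ℝ n (lineHilbert e u) x‖ ≤ C * (1 + ‖x‖) ^ k := by
  induction n with
  | zero =>
    intro F _ _ u hu
    obtain ⟨C, -, h1, h2⟩ := hu.exists_bound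
    refine ⟨contDiff_zero.2 <| continuous_iff_continuousAt.2 fun z =>
      (hasFDerivAt_lineHilbert he hu z).continuousAt, 1, 4 * C * Real.pi, fun z => ?_⟩
    simpa using norm_lineHilbert_le he hu.differentiable h1 h2 z
  | succ n ih =>
    intro F _ _ u hu
    obtain ⟨h1, k, C, h2⟩ := ih hu.fderiv
    refine ⟨(contDiff_succ_iff_fderiv (n := (n : WithTop ℕ∞))).2 ⟨fun z =>
      (hasFDerivAt_lineHilbert he hu z).differentiableAt, by simp, ?_⟩, k, C, fun z => ?_⟩
    · rwa [fderiv_lineHilbert he hu]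
    · rw [← norm_iteratedFDeriv_fderiv, fderiv_lineHilbert he hu]
      exact h2 z

theorem IsSchwartz.lineHilbert {F : Type w} [NormedAddCommGroup F] [NormedSpace ℝ F] {e : E}
    (he : ‖e‖ = 1) {u : E → F} (hu : IsSchwartz u) :
    (lineHilbert e u).HasTemperateGrowth :=
  ⟨contDiff_infty.2 fun n => (lineHilbert_temperate_aux he n hu).1,
    fun n => (lineHilbert_temperate_aux he n hu).2⟩

end Smooth

/-! ### The principal value on the real line -/

section RealLine

variable {𝕜 : Type*} [RCLike 𝕜]

theorem integrableOn_div_of_lt_abs {u : ℝ → 𝕜} (hu : Integrable u) {ε : ℝ} (hε : 0 < ε) :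
    IntegrableOn (fun s => u s / (s : 𝕜)) {s : ℝ | ε < |s|} := by
  have hm : MeasurableSet {s : ℝ | ε < |s|} := measurableSet_lt measurable_const measurable_norm
  refine Integrable.mono' ((hu.norm.const_mul ε⁻¹).restrict (s := {s : ℝ | ε < |s|})) ?_ ?_
  · simp only [div_eq_mul_inv]
    exact hu.1.restrict.mul (RCLike.measurable_ofReal (𝕜 := 𝕜)).inv.aestronglyMeasurable
  · filter_upwards [ae_restrict_mem hm] with s hs
    rw [norm_div, RCLike.norm_ofReal, div_eq_inv_mul]
    have : ε ≤ |s| := le_of_lt hs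
    gcongr

/-- Substituting q = p - s and pairing s with -s folds the truncated integral onto a half-line,
where the oddness of 1/s produces the difference. -/
theorem setIntegral_lt_abs_div {u : ℝ → 𝕜} (hu : Integrable u) (p : ℝ) {ε : ℝ} (hε : 0 < ε) :
    ∫ q in {q : ℝ | ε < |p - q|}, u q / ((p - q : ℝ) : 𝕜) =
      ∫ s in Set.Ioi ε, s⁻¹ • (u (p - s • 1) - u (p + s • 1)) := by
  have hm : MeasurableSet {s : ℝ | ε < |s|} := measurableSet_lt measurable_const measurable_norm
  have hm' : MeasurableSet {q : ℝ | ε < |p - q|} :=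
    hm.preimage (measurable_const.sub measurable_id)
  have h1 : ∫ q in {q : ℝ | ε < |p - q|}, u q / ((p - q : ℝ) : 𝕜) =
      ∫ s in {s : ℝ | ε < |s|}, u (p - s) / (s : 𝕜) := by
    rw [← integral_indicator hm', ← integral_indicator hm, ← integral_sub_left_eq_self _ _ p]
    refine integral_congr_ae (Eventually.of_forall fun s => ?_)
    simp [Set.indicator_apply]
  have h2 : {s : ℝ | ε < |s|} = Set.Iic (-ε) \ {-ε} ∪ Set.Ioi ε := by
    rw [Set.Iic_sdiff_right]
    ext s
    simp [lt_abs, or_comm, lt_neg]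
  have hi := integrableOn_div_of_lt_abs (hu.comp_sub_left p) hε
  rw [h2, Set.Iic_sdiff_right, integrableOn_union] at hi
  rw [h1, h2, Set.Iic_sdiff_right, setIntegral_union (by
      rw [Set.disjoint_left]
      intro s hs hs'
      simp only [Set.mem_Iio, Set.mem_Ioi] at hs hs'
      linarith) measurableSet_Ioi hi.1 hi.2,
    ← integral_Iic_eq_integral_Iio, ← integral_comp_neg_Ioi, ← integral_add ?_ hi.2]
  · refine integral_congr_ae (Eventually.of_forall fun s => ?_)
    simp only [smul_eq_mul, mul_one, RCLike.real_smul_eq_coe_mul, RCLike.ofReal_neg,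
      RCLike.ofReal_inv, sub_neg_eq_add]
    ring
  · exact hi.1.comp_neg_Ioi

/-- The folded integrand is integrable on the whole half-line, so the truncated integrals converge
to its integral as ε → 0. -/
theorem pv_eq_lineHilbert {u : ℝ → 𝕜} (hu : IsSchwartz u) (p : ℝ) :
    pv u p = lineHilbert (1 : ℝ) u p := by
  have hc : AECover (volume.restrict (Set.Ioi (0 : ℝ))) (𝓝[>] (0 : ℝ)) fun ε => Set.Ioi ε :=
    aecover_Ioi_of_Ioi (tendsto_id.mono_left nhdsWithin_le_nhds)
  have ht := hc.integral_tendsto_of_countably_generated (integrable_kernel norm_one hu p)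
  refine Tendsto.limUnder_eq (ht.congr' ?_)
  filter_upwards [self_mem_nhdsWithin] with ε hε
  rw [setIntegral_lt_abs_div hu.integrable p hε, Measure.restrict_restrict measurableSet_Ioi,
    Set.inter_eq_left.2 (Set.Ioi_subset_Ioi (le_of_lt hε))]

theorem integral_Ioi_sub_add_add {u : ℝ → 𝕜} (hu : Integrable u) (p : ℝ) :
    ∫ s in Set.Ioi (0 : ℝ), (u (p - s) + u (p + s)) = ∫ q, u q := by
  rw [integral_add (hu.comp_sub_left p).integrableOn (hu.comp_add_left p).integrableOn]
  have h := integral_comp_neg_Ioi 0 (fun s => u (p + s))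
  simp only [← sub_eq_add_neg, neg_zero] at h
  rw [h, intervalIntegral.integral_Iic_add_Ioi (hu.comp_add_left p).integrableOn
    (hu.comp_add_left p).integrableOn, integral_add_left_eq_self]

/-- Write q - a = (p - a) - (p - q); the second term cancels the kernel 1/(p - q). -/
theorem lineHilbert_sub_mul {u : ℝ → 𝕜} (hu : IsSchwartz u) (a p : ℝ) :
    lineHilbert (1 : ℝ) (fun q => ((q - a : ℝ) : 𝕜) * u q) p =
      ((p - a : ℝ) : 𝕜) * lineHilbert (1 : ℝ) u p - ∫ q, u q := by
  have hi : IntegrableOn (fun s => u (p - s) + u (p + s)) (Set.Ioi 0) :=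
    (hu.integrable.comp_sub_left p).integrableOn.add (hu.integrable.comp_add_left p).integrableOn
  rw [← integral_Ioi_sub_add_add hu.integrable p, lineHilbert, lineHilbert, ← integral_const_mul,
    ← integral_sub ((integrable_kernel norm_one hu p).const_mul _) hi]
  refine setIntegral_congr_fun measurableSet_Ioi fun s hs => ?_
  have : (s : 𝕜) ≠ 0 := by exact_mod_cast ne_of_gt hs
  simp only [smul_eq_mul, mul_one, RCLike.real_smul_eq_coe_mul, RCLike.ofReal_inv,
    RCLike.ofReal_sub, RCLike.ofReal_add]
  field_simp
  ring

end RealLine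

/-! ### Antisymmetry -/

section Antisymmetry

variable {𝕜 : Type*} [RCLike 𝕜] {E : Type*} [NormedAddCommGroup E] [NormedSpace ℝ E]
  [MeasurableSpace E] [BorelSpace E] [SecondCountableTopology E]
  (μ : Measure E) [μ.IsAddRightInvariant] [μ.HasTemperateGrowth]

theorem integral_mul_sub_shift {u v : E → 𝕜} (hu : IsSchwartz u) (hv : IsSchwartz v) (w : E) :
    ∫ z, u z * (v (z - w) - v (z + w)) ∂μ = ∫ z, (u (z + w) - u (z - w)) * v z ∂μ := by
  obtain ⟨C, -, hC⟩ := hv.exists_decay 0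
  obtain ⟨C', -, hC'⟩ := hu.exists_decay 0
  have i1 : ∀ w : E, Integrable (fun z => u z * v (z + w)) μ := fun w =>
    hu.integrable.mul_bdd (c := C) ((hv.continuous.comp
      (continuous_id.add continuous_const)).aestronglyMeasurable)
      (Eventually.of_forall fun z => by simpa using hC (z + w))
  have i2 : ∀ w : E, Integrable (fun z => u (z + w) * v z) μ := fun w =>
    hv.integrable.bdd_mul (c := C') ((hu.continuous.comp
      (continuous_id.add continuous_const)).aestronglyMeasurable)
      (Eventually.of_forall fun z => by simpa using hC' (z + w))
  have e : ∀ w : E, ∫ z, u z * v (z + w) ∂μ = ∫ z, u (z - w) * v z ∂μ := fun w => by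
    rw [← integral_add_right_eq_self (fun z => u (z - w) * v z) w]
    simp
  have e' : ∀ w : E, ∫ z, u z * v (z - w) ∂μ = ∫ z, u (z + w) * v z ∂μ := fun w => by
    simpa [sub_eq_add_neg] using e (-w)
  simp only [mul_sub, sub_mul]
  rw [integral_sub (by simpa [sub_eq_add_neg] using i1 (-w)) (i1 w),
    integral_sub (i2 w) (by simpa [sub_eq_add_neg] using i2 (-w)), e, e']

/-- The kernel is odd. Fubini moves the z-integral inside, where translation invariance of μ shifts
the difference from one factor to the other with a change of sign. -/
theorem integral_mul_lineHilbert [SFinite μ] {e : E} (he : ‖e‖ = 1) {u v : E → 𝕜} (hu : IsSchwartz u)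
    (hv : IsSchwartz v) :
    ∫ z, u z * lineHilbert e v z ∂μ = -∫ z, lineHilbert e u z * v z ∂μ := by
  have key : ∀ {u v : E → 𝕜}, IsSchwartz u → IsSchwartz v →
      ∫ z, u z * lineHilbert e v z ∂μ =
        ∫ s in Set.Ioi (0 : ℝ), s⁻¹ • ∫ z, u z * (v (z - s • e) - v (z + s • e)) ∂μ := by
    intro u v hu hv
    obtain ⟨C, hC, h1, h2⟩ := hv.exists_bound
    have hi : Integrable (Function.uncurry fun z (s : ℝ) =>
        u z * (s⁻¹ • (v (z - s • e) - v (z + s • e)))) (μ.prod (volume.restrict (Set.Ioi 0))) := by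
      -- The kernel bound grows linearly in z and decays like 1/(1+s²), so weighted integrability of
      -- u suffices for Fubini.
      have hu1 : Integrable (fun z => (1 + ‖z‖) * ‖u z‖) μ := by
        obtain ⟨U, rfl⟩ := hu
        have := (U.integrable_pow_mul μ 0).add (U.integrable_pow_mul μ 1)
        refine this.congr (Eventually.of_forall fun z => ?_)
        simp only [Pi.add_apply]
        ring
      refine Integrable.mono' ((hu1.const_mul (4 * C)).mul_prod
        (integrable_inv_one_add_sq.restrict (s := Set.Ioi 0))) ?_ ?_
      · refine AEStronglyMeasurable.mul (hu.continuous.comp continuous_fst).aestronglyMeasurable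
          (AEStronglyMeasurable.smul
            (measurable_snd.inv.aestronglyMeasurable (β := ℝ)) ?_)
        have := hv.continuous
        exact Continuous.aestronglyMeasurable (by fun_prop)
      · have : ∀ᵐ x ∂(μ.prod (volume.restrict (Set.Ioi (0 : ℝ)))), x.2 ∈ Set.Ioi (0 : ℝ) :=
          Measure.quasiMeasurePreserving_snd.ae (ae_restrict_mem measurableSet_Ioi)
        filter_upwards [this] with x hx
        have := norm_kernel_le he hv.differentiable h1 h2 x.1 hx
        simp only [Function.uncurry, norm_mul]
        calc _ ≤ ‖u x.1‖ * (4 * C * (1 + ‖x.1‖) * (1 + x.2 ^ 2)⁻¹) := by gcongr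
          _ = _ := by ring
    simp only [lineHilbert, ← integral_const_mul]
    rw [integral_integral_swap hi]
    refine integral_congr_ae (Eventually.of_forall fun s => ?_)
    simp only [← integral_smul]
    refine integral_congr_ae (Eventually.of_forall fun z => ?_)
    simp only [mul_smul_comm]
  rw [key hu hv]
  simp only [mul_comm (lineHilbert e u _)]
  rw [key hv hu, ← integral_neg]
  refine integral_congr_ae (Eventually.of_forall fun s => ?_)
  simp only
  rw [← smul_neg, ← integral_neg, integral_mul_sub_shift μ hu hv]
  congr 2
  ext z
  ring

end Antisymmetry

/-! ### Division of Schwartz functions by a coordinate -/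

section Division

variable {F : Type*} [NormedAddCommGroup F] [NormedSpace ℝ F]

theorem IsSchwartz.comp_sub_const {E : Type*} [NormedAddCommGroup E] [NormedSpace ℝ E]
    {u : E → F} (hu : IsSchwartz u) (a : E) : IsSchwartz (fun z => u (z - a)) := by
  obtain ⟨U, rfl⟩ := hu
  exact ⟨compSubConstCLM ℝ a U, by ext; simp⟩

theorem IsSchwartz.iteratedDeriv_decay {u : ℝ → F} (hu : IsSchwartz u) (k n : ℕ) :
    ∃ C : ℝ, 0 ≤ C ∧ ∀ q, |q| ^ k * ‖iteratedDeriv n u q‖ ≤ C := by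
  obtain ⟨U, rfl⟩ := hu
  obtain ⟨C, hC, h⟩ := U.decay k n
  exact ⟨C, hC.le, fun q => by
    rw [← norm_iteratedFDeriv_eq_norm_iteratedDeriv]; exact h q⟩

/-- The function `∫₀¹ tⁿ u⁽ⁿ⁺¹⁾(t q) dt`, the `n`-th derivative of `(u q - u 0) / q`. -/
def hadamard (u : ℝ → F) (n : ℕ) (q : ℝ) : F :=
  ∫ t in (0 : ℝ)..1, t ^ n • iteratedDeriv (n + 1) u (t * q)

variable {u : ℝ → F} (hu : IsSchwartz u)

include hu

theorem IsSchwartz.hasDerivAt_iteratedDeriv (n : ℕ) (q : ℝ) :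
    HasDerivAt (iteratedDeriv n u) (iteratedDeriv (n + 1) u q) q := by
  rw [iteratedDeriv_succ]
  exact ((hu.contDiff.differentiable_iteratedDeriv n (by exact_mod_cast WithTop.coe_lt_top _))
    q).hasDerivAt

theorem hasDerivAt_hadamard (n : ℕ) (q : ℝ) :
    HasDerivAt (hadamard u n) (hadamard u (n + 1) q) q := by
  obtain ⟨C, hC, h⟩ := hu.iteratedDeriv_decay 0 (n + 1 + 1)
  have hc : ∀ n, Continuous (iteratedDeriv n u) := fun n =>
    hu.contDiff.continuous_iteratedDeriv n (by exact_mod_cast le_top)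
  have hcc : ∀ n q, Continuous fun t : ℝ => t ^ n • iteratedDeriv (n + 1) u (t * q) := fun n q => by
    have := hc (n + 1)
    fun_prop
  refine (intervalIntegral.hasDerivAt_integral_of_dominated_loc_of_deriv_le
    (F := fun q t => t ^ n • iteratedDeriv (n + 1) u (t * q))
    (F' := fun q t => t ^ (n + 1) • iteratedDeriv (n + 1 + 1) u (t * q))
    (bound := fun _ => C) (Filter.univ_mem)
    (Eventually.of_forall fun x => (hcc n x).aestronglyMeasurable)
    ((hcc n q).intervalIntegrable _ _) (hcc (n + 1) q).aestronglyMeasurable ?_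
    intervalIntegrable_const ?_).2
  · refine Eventually.of_forall fun t ht x _ => ?_
    rw [Set.uIoc_of_le zero_le_one] at ht
    rw [norm_smul, norm_pow, Real.norm_of_nonneg ht.1.le]
    calc _ ≤ 1 * ‖iteratedDeriv (n + 1 + 1) u (t * x)‖ := by
          gcongr
          exact pow_le_one₀ ht.1.le ht.2
      _ ≤ C := by simpa using h (t * x)
  · refine Eventually.of_forall fun t _ x _ => ?_
    have h1 := (hu.hasDerivAt_iteratedDeriv (n + 1) (t * x)).scomp x
      ((hasDerivAt_id x).const_mul t)
    refine (h1.const_smul (t ^ n)).congr_deriv ?_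
    rw [mul_one, smul_smul, pow_succ]

theorem iteratedDeriv_hadamard (n : ℕ) : iteratedDeriv n (hadamard u 0) = hadamard u n := by
  induction n with
  | zero => simp
  | succ n ih =>
    rw [iteratedDeriv_succ, ih]
    exact funext fun q => (hasDerivAt_hadamard hu n q).deriv

theorem norm_hadamard_le (n : ℕ) : ∃ C, 0 ≤ C ∧ ∀ q, ‖hadamard u n q‖ ≤ C := by
  obtain ⟨C, hC, h⟩ := hu.iteratedDeriv_decay 0 (n + 1)
  refine ⟨C, hC, fun q => ?_⟩
  refine (intervalIntegral.norm_integral_le_of_norm_le_const (C := C) fun t ht => ?_).trans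
    (by simp)
  rw [Set.uIoc_of_le zero_le_one] at ht
  rw [norm_smul, norm_pow, Real.norm_of_nonneg ht.1.le]
  calc _ ≤ 1 * ‖iteratedDeriv (n + 1) u (t * q)‖ := by
        gcongr
        exact pow_le_one₀ ht.1.le ht.2
    _ ≤ C := by simpa using h (t * q)

variable [CompleteSpace F]

theorem smul_hadamard_zero (q : ℝ) : q • hadamard u 0 q = u q - u 0 := by
  have h : ∀ t ∈ Set.uIcc (0 : ℝ) 1, HasDerivAt (fun t => u (t * q))
      (q • iteratedDeriv 1 u (t * q)) t := fun t _ => by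
    have h1 := hu.hasDerivAt_iteratedDeriv 0 (t * q)
    rw [iteratedDeriv_zero] at h1
    exact (h1.scomp t ((hasDerivAt_id t).mul_const q)).congr_deriv (by rw [one_mul])
  have hc : Continuous (iteratedDeriv 1 u) :=
    hu.contDiff.continuous_iteratedDeriv 1 (by exact_mod_cast le_top)
  have := intervalIntegral.integral_eq_sub_of_hasDerivAt h
    ((by fun_prop : Continuous fun t : ℝ => q • iteratedDeriv 1 u (t * q)).intervalIntegrable _ _)
  rw [one_mul, zero_mul] at this
  rw [← this, hadamard, ← intervalIntegral.integral_smul]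
  simp

/-- This is Leibniz' rule for the n-th derivative of u(q) = q · (u(q)/q). For n = 0 the truncated
index n - 1 is multiplied by zero. -/
theorem smul_hadamard (h0 : u 0 = 0) (n : ℕ) (q : ℝ) :
    q • hadamard u n q + (n : ℝ) • hadamard u (n - 1) q = iteratedDeriv n u q := by
  induction n generalizing q with
  | zero => simp [smul_hadamard_zero hu q, h0]
  | succ n ih =>
    have h1 : HasDerivAt (iteratedDeriv n u)
        (q • hadamard u (n + 1) q + (1 : ℝ) • hadamard u n q + (n : ℝ) • hadamard u n q) q := by
      rw [← funext ih]
      refine ((hasDerivAt_id q).smul (hasDerivAt_hadamard hu n q)).add ?_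
      rcases n with _ | n
      · simpa using hasDerivAt_const q (0 : F)
      · exact (hasDerivAt_hadamard hu n q).const_smul _
    rw [(hu.hasDerivAt_iteratedDeriv n q).unique h1, Nat.add_sub_cancel, add_assoc, ← add_smul]
    push_cast
    rw [add_comm (1 : ℝ)]

/-- Near the origin the quotient is bounded. For |q| ≥ 1 the identity `smul_hadamard` bounds its
n-th derivative by that of u and by its own derivative of order n - 1, whence the induction. -/
theorem hadamard_decay (h0 : u 0 = 0) (k n : ℕ) :
    ∃ C, 0 ≤ C ∧ ∀ q, |q| ^ k * ‖hadamard u n q‖ ≤ C := by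
  have step : ∀ n : ℕ, (∃ C, 0 ≤ C ∧ ∀ q, (n : ℝ) * (|q| ^ k * ‖hadamard u (n - 1) q‖) ≤ C) →
      ∃ C, 0 ≤ C ∧ ∀ q, |q| ^ k * ‖hadamard u n q‖ ≤ C := by
    rintro n ⟨C₁, hC₁, h₁⟩
    obtain ⟨C₂, hC₂, h₂⟩ := hu.iteratedDeriv_decay k n
    obtain ⟨C₃, hC₃, h₃⟩ := norm_hadamard_le hu n
    refine ⟨C₁ + C₂ + C₃, by positivity, fun q => ?_⟩
    rcases le_total |q| 1 with hq | hq
    · calc _ ≤ 1 * C₃ := by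
            gcongr
            · exact pow_le_one₀ (abs_nonneg q) hq
            · exact h₃ q
        _ ≤ _ := by linarith
    · have : ‖hadamard u n q‖ ≤ ‖iteratedDeriv n u q‖ + n * ‖hadamard u (n - 1) q‖ := by
        calc ‖hadamard u n q‖ ≤ |q| * ‖hadamard u n q‖ := le_mul_of_one_le_left (norm_nonneg _) hq
          _ = ‖iteratedDeriv n u q - (n : ℝ) • hadamard u (n - 1) q‖ := by
            rw [← smul_hadamard hu h0 n q, add_sub_cancel_right, norm_smul, Real.norm_eq_abs]
          _ ≤ _ := (norm_sub_le _ _).trans (by simp [norm_smul])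
      calc _ ≤ |q| ^ k * (‖iteratedDeriv n u q‖ + n * ‖hadamard u (n - 1) q‖) := by gcongr
        _ = |q| ^ k * ‖iteratedDeriv n u q‖ + n * (|q| ^ k * ‖hadamard u (n - 1) q‖) := by ring
        _ ≤ C₂ + C₁ := add_le_add (h₂ q) (h₁ q)
        _ ≤ _ := by linarith
  induction n with
  | zero => exact step 0 ⟨0, le_rfl, by simp⟩
  | succ n ih =>
    obtain ⟨C, hC, h⟩ := ih
    refine step (n + 1) ⟨(n + 1) * C, by positivity, fun q => ?_⟩
    push_cast
    gcongr
    exact h q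

theorem isSchwartz_hadamard (h0 : u 0 = 0) : IsSchwartz (hadamard u 0) := by
  refine ⟨⟨hadamard u 0, contDiff_of_differentiable_iteratedDeriv (n := ⊤) fun m _ => ?_,
    fun k n => ?_⟩, rfl⟩
  · rw [iteratedDeriv_hadamard hu]
    exact fun q => (hasDerivAt_hadamard hu m q).differentiableAt
  · obtain ⟨C, -, hC⟩ := hadamard_decay hu h0 k n
    refine ⟨C, fun q => ?_⟩
    rw [norm_iteratedFDeriv_eq_norm_iteratedDeriv, iteratedDeriv_hadamard hu]
    exact hC q

/-- A Schwartz function vanishing at `a` is `(q - a) v(q)` with `v` Schwartz. -/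
theorem IsSchwartz.exists_eq_sub_smul {a : ℝ} (h0 : u a = 0) :
    ∃ v : ℝ → F, IsSchwartz v ∧ ∀ q, u q = (q - a) • v q := by
  have hw : IsSchwartz (fun q => u (q + a)) := by
    simpa using hu.comp_sub_const (-a)
  refine ⟨fun q => hadamard (fun q => u (q + a)) 0 (q - a),
    (isSchwartz_hadamard hw (by simpa using h0)).comp_sub_const a, fun q => ?_⟩
  simp [smul_hadamard_zero hw, h0]

end Division

/-! ### The product formula for principal values -/

section Tricomi

variable {𝕜 : Type*} [RCLike 𝕜]

/-- The defect `Pu Pv - P(u Pv) - P(v Pu)` in the product formula for `P = lineHilbert 1`. -/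
def tricomiDefect (u v : ℝ → 𝕜) (p : ℝ) : 𝕜 :=
  lineHilbert (1 : ℝ) u p * lineHilbert (1 : ℝ) v p
    - lineHilbert (1 : ℝ) (fun q => u q * lineHilbert (1 : ℝ) v q) p
    - lineHilbert (1 : ℝ) (fun q => v q * lineHilbert (1 : ℝ) u q) p

theorem tricomiDefect_comm (u v : ℝ → 𝕜) (p : ℝ) : tricomiDefect u v p = tricomiDefect v u p := by
  unfold tricomiDefect
  ring

variable {u v w : ℝ → 𝕜}

theorem isSchwartz_mul_lineHilbert (hu : IsSchwartz u) (hv : IsSchwartz v) :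
    IsSchwartz (fun q => u q * lineHilbert (1 : ℝ) v q) :=
  hu.mul_right (hv.lineHilbert norm_one)

/-- With w = (q - p)v, every principal value of (q - p) times a function, taken at p, reduces to
minus an integral. The terms Pu(p) ∫ v cancel and ∫ u Pv + ∫ v Pu remains, which vanishes by
antisymmetry. -/
theorem tricomiDefect_eq_zero (hu : IsSchwartz u) (hw : IsSchwartz w) {p : ℝ} (h0 : w p = 0) :
    tricomiDefect u w p = 0 := by
  obtain ⟨v, hv, h⟩ := hw.exists_eq_sub_smul h0
  obtain rfl : w = fun q => ((q - p : ℝ) : 𝕜) * v q :=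
    funext fun q => by rw [h q, RCLike.real_smul_eq_coe_mul]
  have e1 : (fun q => u q * lineHilbert (1 : ℝ) (fun q => ((q - p : ℝ) : 𝕜) * v q) q) =
      fun q => ((q - p : ℝ) : 𝕜) * (u q * lineHilbert (1 : ℝ) v q) - (∫ q, v q) * u q := by
    ext q
    rw [lineHilbert_sub_mul hv]
    ring
  have e2 : (fun q => ((q - p : ℝ) : 𝕜) * v q * lineHilbert (1 : ℝ) u q) =
      fun q => ((q - p : ℝ) : 𝕜) * (v q * lineHilbert (1 : ℝ) u q) := by
    ext q
    ring
  have ht : (fun q : ℝ => ((q - p : ℝ) : 𝕜)).HasTemperateGrowth :=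
    (Function.RCLike.hasTemperateGrowth_ofReal (𝕜 := 𝕜)).comp
      (Function.HasTemperateGrowth.id'.sub (Function.HasTemperateGrowth.const p))
  have a := integral_mul_lineHilbert volume norm_one hu hv
  have e3 : ∫ z, lineHilbert 1 u z * v z = ∫ z, v z * lineHilbert 1 u z := by
    simp only [mul_comm]
  rw [tricomiDefect, e1, e2, lineHilbert_sub_mul hv,
    lineHilbert_sub norm_one ((isSchwartz_mul_lineHilbert hu hv).mul_left ht) (hu.const_mul _),
    lineHilbert_sub_mul (isSchwartz_mul_lineHilbert hu hv), lineHilbert_const_mul,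
    lineHilbert_sub_mul (isSchwartz_mul_lineHilbert hv hu), a, e3]
  simp
  ring

theorem tricomiDefect_mul_sub (hu : IsSchwartz u) (hv : IsSchwartz v) (hw : IsSchwartz w) (a b : 𝕜)
    (p : ℝ) : tricomiDefect u (fun q => a * v q - b * w q) p =
      a * tricomiDefect u v p - b * tricomiDefect u w p := by
  have e1 : (fun q => u q * lineHilbert (1 : ℝ) (fun q => a * v q - b * w q) q) =
      fun q => a * (u q * lineHilbert (1 : ℝ) v q) - b * (u q * lineHilbert (1 : ℝ) w q) := by
    ext q
    rw [lineHilbert_sub norm_one (hv.const_mul a) (hw.const_mul b), lineHilbert_const_mul,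
      lineHilbert_const_mul]
    ring
  have e2 : (fun q => (a * v q - b * w q) * lineHilbert (1 : ℝ) u q) =
      fun q => a * (v q * lineHilbert (1 : ℝ) u q) - b * (w q * lineHilbert (1 : ℝ) u q) := by
    ext q
    ring
  rw [tricomiDefect, e1, e2, lineHilbert_sub norm_one (hv.const_mul a) (hw.const_mul b),
    lineHilbert_sub norm_one ((isSchwartz_mul_lineHilbert hu hv).const_mul a)
      ((isSchwartz_mul_lineHilbert hu hw).const_mul b),
    lineHilbert_sub norm_one ((isSchwartz_mul_lineHilbert hv hu).const_mul a)
      ((isSchwartz_mul_lineHilbert hw hu).const_mul b), tricomiDefect, tricomiDefect]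
  simp only [lineHilbert_const_mul]
  ring

/-- The combination w(p) v - v(p) w vanishes at p, so its defect with u does too. Hence the defect
at p depends on its second argument only through the value at p, and linearly. -/
theorem tricomiDefect_mul_comm (hu : IsSchwartz u) (hv : IsSchwartz v) (hw : IsSchwartz w)
    (p : ℝ) : tricomiDefect u v p * w p = tricomiDefect u w p * v p := by
  have h := tricomiDefect_mul_sub hu hv hw (w p) (v p) p
  rw [tricomiDefect_eq_zero hu ((hv.const_mul _).sub (hw.const_mul _)) (by ring)] at h
  linear_combination -h

theorem lineHilbert_comp_sub (u : ℝ → 𝕜) (a p : ℝ) :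
    lineHilbert (1 : ℝ) (fun q => u (q - a)) p = lineHilbert (1 : ℝ) u (p - a) := by
  simp only [lineHilbert, smul_eq_mul, mul_one]
  refine integral_congr_ae (Eventually.of_forall fun s => ?_)
  simp only [sub_right_comm p s a, add_sub_right_comm p s a]

theorem tricomiDefect_comp_sub (u v : ℝ → 𝕜) (a p : ℝ) :
    tricomiDefect (fun q => u (q - a)) (fun q => v (q - a)) p = tricomiDefect u v (p - a) := by
  simp only [tricomiDefect, lineHilbert_comp_sub]
  rw [lineHilbert_comp_sub (fun q => u q * lineHilbert (1 : ℝ) v q),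
    lineHilbert_comp_sub (fun q => v q * lineHilbert (1 : ℝ) u q)]

/-- Serves both as a test function with value 1 at a point, to normalise the constant of the product
formula, and as a cut-off in the parameter ε. -/
theorem exists_isSchwartz_eq_one (𝕜 : Type*) [RCLike 𝕜] (E : Type*) [NormedAddCommGroup E]
    [NormedSpace ℝ E] [FiniteDimensional ℝ E] :
    ∃ u : E → 𝕜, IsSchwartz u ∧ ∀ z ∈ Metric.closedBall (0 : E) 1, u z = 1 := by
  let b : ContDiffBump (0 : E) := ⟨1, 2, one_pos, one_lt_two⟩
  have hc : HasCompactSupport (fun x => (b x : 𝕜)) :=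
    b.hasCompactSupport.comp_left (g := fun r : ℝ => (r : 𝕜)) (by simp)
  have hs : ContDiff ℝ ∞ (fun x => (b x : 𝕜)) :=
    (RCLike.ofRealCLM (K := 𝕜)).contDiff.comp b.contDiff
  exact ⟨fun x => (b x : 𝕜), ⟨hc.toSchwartzMap hs, rfl⟩, fun z hz => by
    simp only [b.one_of_mem_closedBall hz, RCLike.ofReal_one]⟩

/-- The product formula for principal values. -/
theorem exists_lineHilbert_mul_lineHilbert (𝕜 : Type*) [RCLike 𝕜] :
    ∃ c : 𝕜, ∀ u v : ℝ → 𝕜, IsSchwartz u → IsSchwartz v → ∀ p,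
      lineHilbert (1 : ℝ) u p * lineHilbert (1 : ℝ) v p =
        lineHilbert (1 : ℝ) (fun q => u q * lineHilbert (1 : ℝ) v q) p
          + lineHilbert (1 : ℝ) (fun q => v q * lineHilbert (1 : ℝ) u q) p + c * (u p * v p) := by
  obtain ⟨b, hb, h1⟩ := exists_isSchwartz_eq_one 𝕜 ℝ
  -- The defect is local in each argument, so comparison with the bump moved to p gives u(p) v(p)
  -- times the defect of that bump with itself; translation invariance makes this factor independent
  -- of p.
  refine ⟨tricomiDefect b b 0, fun u v hu hv p => ?_⟩
  have hp := hb.comp_sub_const p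
  have e1 := tricomiDefect_mul_comm hu hv hp p
  have e2 := tricomiDefect_mul_comm hp hu hp p
  rw [tricomiDefect_comm] at e2
  have e3 := tricomiDefect_comp_sub b b p p
  simp only [sub_self, h1 0 (by simp), mul_one] at e1 e2 e3
  rw [e2, e3, tricomiDefect] at e1
  linear_combination e1

end Tricomi

/-! ### Compositions and tensor products -/

section Composition

variable {𝕜 : Type*} [RCLike 𝕜] {E : Type*} [NormedAddCommGroup E] [NormedSpace ℝ E]

/-- Only the derivatives of h on a compact ball containing the range of u enter, and these are
bounded. -/
theorem hasTemperateGrowth_comp_of_bounded {h : 𝕜 → 𝕜} (hh : ContDiff ℝ ∞ h) {u : E → 𝕜}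
    (hu : u.HasTemperateGrowth) {R : ℝ} (hR : ∀ z, ‖u z‖ ≤ R) :
    (fun z => h (u z)).HasTemperateGrowth := by
  -- The radius `max R 1` is positive, so the ball has nonempty interior and derivatives within it
  -- are unique.
  have hu' : UniqueDiffOn ℝ (Metric.closedBall (0 : 𝕜) (max R 1)) :=
    uniqueDiffOn_convex (convex_closedBall _ _)
      ⟨0, Metric.ball_subset_interior_closedBall (by simp)⟩
  refine hu.comp' (t := Metric.closedBall 0 (max R 1)) ?_ hu' hh.contDiffOn fun N => ?_
  · rintro _ ⟨z, rfl⟩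
    simpa using le_max_of_le_left (hR z)
  · have hb : ∀ n, ∃ C, ∀ y ∈ Metric.closedBall (0 : 𝕜) (max R 1),
        ‖iteratedFDerivWithin ℝ n h (Metric.closedBall 0 (max R 1)) y‖ ≤ C := fun n =>
      (isCompact_closedBall _ _).exists_bound_of_continuousOn
        (hh.contDiffOn.continuousOn_iteratedFDerivWithin (by exact_mod_cast le_top) hu')
    choose C hC using hb
    refine ⟨0, ∑ n ∈ Finset.range (N + 1), |C n|, by positivity, fun n hn y hy => ?_⟩
    rw [pow_zero, mul_one]
    exact (hC n y hy).trans <| (le_abs_self _).trans <|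
      Finset.single_le_sum (f := fun n => |C n|) (fun _ _ => abs_nonneg _)
        (Finset.mem_range.2 (by omega))

theorem IsSchwartz.hasTemperateGrowth_comp {h : 𝕜 → 𝕜} (hh : ContDiff 𝕜 ∞ h) {u : E → 𝕜}
    (hu : IsSchwartz u) : (fun z => h (u z)).HasTemperateGrowth := by
  obtain ⟨C, -, hC⟩ := hu.exists_decay 0
  exact hasTemperateGrowth_comp_of_bounded (hh.restrict_scalars ℝ) hu.hasTemperateGrowth
    (R := C) fun z => by simpa using hC z

theorem hasFDerivAt_comp_of_contDiff {h : 𝕜 → 𝕜} (hh : ContDiff 𝕜 ∞ h) {u : E → 𝕜}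
    {z : E} {u' : E →L[ℝ] 𝕜} (hu : HasFDerivAt u u' z) :
    HasFDerivAt (fun z => h (u z)) (deriv h (u z) • u') z := by
  have h1 := ((hh.differentiable (by simp)) (u z)).hasDerivAt.hasFDerivAt.restrictScalars ℝ
  refine (h1.comp z hu).congr_fderiv ?_
  ext d
  simp [mul_comm]

theorem contDiff_deriv {h : 𝕜 → 𝕜} (hh : ContDiff 𝕜 ∞ h) : ContDiff 𝕜 ∞ (deriv h) :=
  (contDiff_infty_iff_deriv.1 hh).2

/-- The derivative h'(u) Du is a function of temperate growth times a Schwartz function. Decay of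
h(u) itself comes from h(0) = 0 and the mean value inequality, |h(u)| ≤ M |u|. -/
theorem IsSchwartz.comp {h : 𝕜 → 𝕜} (hh : ContDiff 𝕜 ∞ h) (h0 : h 0 = 0) {u : E → 𝕜}
    (hu : IsSchwartz u) : IsSchwartz (fun z => h (u z)) := by
  have hd : ∀ z, HasFDerivAt (fun z => h (u z)) (deriv h (u z) • _root_.fderiv ℝ u z) z := fun z =>
    hasFDerivAt_comp_of_contDiff hh (hu.differentiable z).hasFDerivAt
  refine IsSchwartz.of_fderiv (fun z => (hd z).differentiableAt) ?_ fun k => ?_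
  · rw [funext fun z => (hd z).fderiv]
    exact hu.fderiv.smul (hu.hasTemperateGrowth_comp (contDiff_deriv hh))
  · obtain ⟨R, hR0, hR⟩ := hu.exists_decay 0
    obtain ⟨C, hC0, hC⟩ := hu.exists_decay k
    obtain ⟨M, hM⟩ := (isCompact_closedBall (0 : 𝕜) R).exists_bound_of_continuousOn
      (contDiff_deriv hh).continuous.continuousOn
    have hM0 : 0 ≤ M := (norm_nonneg _).trans (hM 0 (by simpa using hR0))
    refine ⟨M * C, fun z => ?_⟩
    have : ‖h (u z) - h 0‖ ≤ M * ‖u z - 0‖ :=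
      (convex_closedBall (0 : 𝕜) R).norm_image_sub_le_of_norm_deriv_le
        (fun y _ => hh.differentiable (by simp) y) hM (by simpa using hR0)
        (by simpa using hR z)
    rw [h0, sub_zero, sub_zero] at this
    calc ‖z‖ ^ k * ‖h (u z)‖ ≤ (1 + ‖z‖) ^ k * (M * ‖u z‖) := by
          gcongr
          linarith
      _ = M * ((1 + ‖z‖) ^ k * ‖u z‖) := by ring
      _ ≤ M * C := by gcongr; exact hC z

theorem norm_iteratedFDeriv_comp_le_of_norm_le_one {D F : Type*} [NormedAddCommGroup D]
    [NormedSpace ℝ D] [NormedAddCommGroup F] [NormedSpace ℝ F] {u : E → F} (hu : ContDiff ℝ ∞ u)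
    (L : D →L[ℝ] E) (hL : ‖L‖ ≤ 1) (n : ℕ) (z : D) :
    ‖iteratedFDeriv ℝ n (fun z => u (L z)) z‖ ≤ ‖iteratedFDeriv ℝ n u (L z)‖ := by
  have := L.iteratedFDeriv_comp_right hu z (i := n) (by exact_mod_cast le_top)
  rw [Function.comp_def] at this
  rw [this]
  refine (ContinuousMultilinearMap.norm_compContinuousLinearMap_le _ _).trans ?_
  refine mul_le_of_le_one_right (norm_nonneg _) ?_
  simpa using pow_le_one₀ (norm_nonneg _) hL

theorem IsSchwartz.tensor {D : Type*} [NormedAddCommGroup D] [NormedSpace ℝ D] {u : D → 𝕜}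
    {v : E → 𝕜} (hu : IsSchwartz u) (hv : IsSchwartz v) :
    IsSchwartz (fun z : D × E => u z.1 * v z.2) := by
  have hc := (hu.contDiff.comp (contDiff_fst (F := E))).mul
    (hv.contDiff.comp (contDiff_snd (E := D)))
  refine ⟨⟨_, hc, fun k n => ?_⟩, rfl⟩
  obtain ⟨U, rfl⟩ := hu
  obtain ⟨V, rfl⟩ := hv
  have hb : ∀ {E : Type _} [NormedAddCommGroup E] [NormedSpace ℝ E] (U : 𝓢(E, 𝕜)),
      ∃ C, 0 ≤ C ∧ ∀ i ≤ n, ∀ z, (1 + ‖z‖) ^ k * ‖iteratedFDeriv ℝ i U z‖ ≤ C := fun U =>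
    ⟨_, by positivity, fun i hi z =>
      one_add_le_sup_seminorm_apply (𝕜 := ℝ) (m := (k, n)) le_rfl hi U z⟩
  obtain ⟨C, hC0, hC⟩ := hb U
  obtain ⟨C', hC0', hC'⟩ : ∃ C, 0 ≤ C ∧ ∀ i ≤ n, ∀ z,
      (1 + ‖z‖) ^ k * ‖iteratedFDeriv ℝ i V z‖ ≤ C :=
    ⟨_, by positivity, fun i hi z =>
      one_add_le_sup_seminorm_apply (𝕜 := ℝ) (m := (k, n)) le_rfl hi V z⟩
  refine ⟨∑ i ∈ Finset.range (n + 1), (n.choose i : ℝ) * (C * C'), fun z => ?_⟩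
  -- The weight on the product space is split so that each factor absorbs its own share.
  have h1 : ‖z‖ ^ k ≤ (1 + ‖z.1‖) ^ k * (1 + ‖z.2‖) ^ k := by
    rw [← mul_pow]
    gcongr
    rw [Prod.norm_def]
    refine max_le ?_ ?_ <;> nlinarith [norm_nonneg z.1, norm_nonneg z.2]
  calc _ ≤ ((1 + ‖z.1‖) ^ k * (1 + ‖z.2‖) ^ k) * ∑ i ∈ Finset.range (n + 1), (n.choose i : ℝ) *
        ‖iteratedFDeriv ℝ i (fun z : D × E => U z.1) z‖ *
        ‖iteratedFDeriv ℝ (n - i) (fun z : D × E => V z.2) z‖ := by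
        gcongr
        exact norm_iteratedFDeriv_mul_le (N := ∞) ((U.smooth ⊤).comp contDiff_fst)
          ((V.smooth ⊤).comp contDiff_snd) z (by exact_mod_cast le_top)
    _ ≤ _ := by
        rw [Finset.mul_sum]
        refine Finset.sum_le_sum fun i hi => ?_
        have hi' : i ≤ n := by simpa [Nat.lt_succ_iff] using hi
        have e1 := norm_iteratedFDeriv_comp_le_of_norm_le_one (U.smooth ⊤)
          (ContinuousLinearMap.fst ℝ D E) (ContinuousLinearMap.norm_fst_le _ _ _) i z
        have e2 := norm_iteratedFDeriv_comp_le_of_norm_le_one (V.smooth ⊤)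
          (ContinuousLinearMap.snd ℝ D E) (ContinuousLinearMap.norm_snd_le _ _ _) (n - i) z
        calc _ ≤ ((1 + ‖z.1‖) ^ k * (1 + ‖z.2‖) ^ k) * ((n.choose i : ℝ) *
              ‖iteratedFDeriv ℝ i U z.1‖ * ‖iteratedFDeriv ℝ (n - i) V z.2‖) := by
              gcongr
              · exact e1
              · exact e2
          _ = (n.choose i : ℝ) * (((1 + ‖z.1‖) ^ k * ‖iteratedFDeriv ℝ i U z.1‖) *
              ((1 + ‖z.2‖) ^ k * ‖iteratedFDeriv ℝ (n - i) V z.2‖)) := by ring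
          _ ≤ _ := by
              gcongr
              · exact hC i hi' _
              · exact hC' (n - i) (by omega) _

end Composition

/-! ### Differentiable curves of Schwartz functions -/

section Curve

variable {𝕜 : Type*} [RCLike 𝕜] {E : Type*} [NormedAddCommGroup E] [NormedSpace ℝ E]

/-- `ε ↦ u ε` is a curve of Schwartz functions near `ε = 0`, jointly smooth in `ε`, with
derivative `v`. -/
def IsSchwartzCurve (u v : 𝕜 → E → 𝕜) : Prop :=
  ∃ U : 𝕜 × E → 𝕜, IsSchwartz U ∧ ∀ ε ∈ Metric.ball (0 : 𝕜) 1, ∀ z,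
    U (ε, z) = u ε z ∧ HasDerivAt (fun ε => u ε z) (v ε z) ε

theorem hasFDerivAt_slice {F : Type*} [NormedAddCommGroup F] [NormedSpace ℝ F] {U : 𝕜 × E → F}
    (hU : Differentiable ℝ U) (ε : 𝕜) (z : E) :
    HasFDerivAt (fun z => U (ε, z)) ((fderiv ℝ U (ε, z)).comp (.inr ℝ 𝕜 E)) z :=
  (hU (ε, z)).hasFDerivAt.comp z (hasFDerivAt_prodMk_right ε z)

/-- U is only real differentiable, so over ℂ its derivative in the parameter must be recorded for
every direction η and not just for η = 1. -/
theorem fderiv_inl_of_hasDerivAt {U : 𝕜 × E → 𝕜} (hU : Differentiable ℝ U) {u : 𝕜 → 𝕜} {ε v : 𝕜}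
    {z : E} (hu : HasDerivAt u v ε) (he : ∀ᶠ η in 𝓝 ε, U (η, z) = u η) (η : 𝕜) :
    fderiv ℝ U (ε, z) (η, 0) = η * v := by
  have h1 := hu.hasFDerivAt.restrictScalars ℝ
  have h2 : HasFDerivAt (fun ε => U (ε, z)) ((fderiv ℝ U (ε, z)).comp (.inl ℝ 𝕜 E)) ε :=
    (hU (ε, z)).hasFDerivAt.comp ε (hasFDerivAt_prodMk_left ε z)
  have h3 := congrArg (fun L => L η) (h2.unique (h1.congr_of_eventuallyEq he))
  simpa using h3

namespace IsSchwartzCurve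

variable {u v : 𝕜 → E → 𝕜}

theorem exists_schwartz (h : IsSchwartzCurve u v) :
    ∃ U V : 𝕜 × E → 𝕜, IsSchwartz U ∧ IsSchwartz V ∧
      ∀ ε ∈ Metric.ball (0 : 𝕜) 1, ∀ z, U (ε, z) = u ε z ∧ V (ε, z) = v ε z ∧
        (∀ η, fderiv ℝ U (ε, z) (η, 0) = η * v ε z) ∧ HasDerivAt (fun ε => U (ε, z)) (v ε z) ε := by
  obtain ⟨U, hU, h⟩ := h
  refine ⟨U, fun x => fderiv ℝ U x (1, 0), hU, hU.fderiv_apply _, fun ε hε z => ?_⟩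
  have he : ∀ᶠ η in 𝓝 ε, U (η, z) = u η z :=
    Filter.mem_of_superset (Metric.isOpen_ball.mem_nhds hε) fun η hη => (h η hη z).1
  have := fderiv_inl_of_hasDerivAt hU.differentiable (h ε hε z).2 he
  exact ⟨(h ε hε z).1, by simpa using this 1, this, (h ε hε z).2.congr_of_eventuallyEq he⟩

/-- On the product space this is a principal value along the unit vector (0, e), so the kernel bound
there dominates the ε-derivative uniformly for |ε| < 1. -/
theorem hasDerivAt_lineHilbert (h : IsSchwartzCurve u v) {e : E} (he : ‖e‖ = 1) (z : E) :
    HasDerivAt (fun ε => lineHilbert e (u ε) z) (lineHilbert e (v 0) z) 0 := by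
  obtain ⟨U, V, hU, hV, h⟩ := h.exists_schwartz
  have he' : ‖((0, e) : 𝕜 × E)‖ = 1 := by simp [Prod.norm_def, he]
  have kU : ∀ (W : 𝕜 × E → 𝕜) (ε : 𝕜) (s : ℝ), s⁻¹ • (W ((ε, z) - s • ((0, e) : 𝕜 × E)) -
      W ((ε, z) + s • ((0, e) : 𝕜 × E))) = s⁻¹ • (W (ε, z - s • e) - W (ε, z + s • e)) := by
    simp
  obtain ⟨C, hC, h1, h2⟩ := hV.exists_bound
  have hU0 : (fun ε => lineHilbert e (u ε) z) =ᶠ[𝓝 0]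
      fun ε => ∫ s in Set.Ioi (0 : ℝ), s⁻¹ • (U (ε, z - s • e) - U (ε, z + s • e)) := by
    filter_upwards [Metric.ball_mem_nhds (0 : 𝕜) one_pos] with ε hε
    simp only [lineHilbert, (h ε hε _).1]
  have hV0 : lineHilbert e (v 0) z =
      ∫ s in Set.Ioi (0 : ℝ), s⁻¹ • (V (0, z - s • e) - V (0, z + s • e)) := by
    simp only [lineHilbert, (h 0 (by simp) _).2.1]
  rw [hV0]
  refine HasDerivAt.congr_of_eventuallyEq ?_ hU0
  refine (hasDerivAt_integral_of_dominated_loc_of_deriv_le (s := Metric.ball (0 : 𝕜) 1)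
    (bound := fun s => 4 * C * (2 + ‖z‖) * (1 + s ^ 2)⁻¹)
    (F := fun ε s => s⁻¹ • (U (ε, z - s • e) - U (ε, z + s • e)))
    (F' := fun ε s => s⁻¹ • (V (ε, z - s • e) - V (ε, z + s • e)))
    (Metric.ball_mem_nhds _ one_pos) (Eventually.of_forall fun ε => ?_) ?_ ?_ ?_
    ((integrable_inv_one_add_sq.restrict).const_mul _) ?_).2
  · simpa only [kU] using aestronglyMeasurable_kernel hU.continuous ((0, e) : 𝕜 × E) (ε, z)
  · simpa only [kU, IntegrableOn] using integrable_kernel he' hU (0, z)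
  · simpa only [kU] using aestronglyMeasurable_kernel hV.continuous ((0, e) : 𝕜 × E) (0, z)
  · filter_upwards [ae_restrict_mem measurableSet_Ioi] with s hs ε hε
    have := norm_kernel_le he' hV.differentiable h1 h2 (ε, z) hs
    rw [kU] at this
    refine this.trans ?_
    have hε1 : ‖ε‖ < 1 := by simpa using hε
    have : 1 + ‖((ε, z) : 𝕜 × E)‖ ≤ 2 + ‖z‖ := by
      have : ‖((ε, z) : 𝕜 × E)‖ ≤ 1 + ‖z‖ := by
        rw [Prod.norm_def]
        exact max_le (by simp only; linarith [norm_nonneg z]) (by simp)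
      linarith
    gcongr
  · refine Eventually.of_forall fun s ε hε => ?_
    simp only [(h ε hε _).2.1]
    exact ((h ε hε _).2.2.2.sub (h ε hε _).2.2.2).fun_const_smul s⁻¹

/-- A Schwartz function of (ε, z) decays rapidly in z uniformly in ε, because ‖z‖ ≤ ‖(ε, z)‖; this
gives the domination. -/
theorem hasDerivAt_integral [MeasurableSpace E] [BorelSpace E] [SecondCountableTopology E]
    (μ : Measure E) [μ.HasTemperateGrowth] (h : IsSchwartzCurve u v) :
    HasDerivAt (fun ε => ∫ z, u ε z ∂μ) (∫ z, v 0 z ∂μ) 0 := by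
  obtain ⟨U, V, hU, hV, h⟩ := h.exists_schwartz
  have decay : ∀ {W : 𝕜 × E → 𝕜}, IsSchwartz W → ∃ C : ℝ, ∀ ε z,
      ‖W (ε, z)‖ ≤ C * (1 + ‖z‖) ^ (-(μ.integrablePower : ℝ)) := by
    intro W hW
    obtain ⟨C, hC, hd⟩ := hW.exists_decay μ.integrablePower
    refine ⟨C, fun ε z => ?_⟩
    rw [Real.rpow_neg (by positivity), Real.rpow_natCast, ← div_eq_mul_inv,
      le_div_iff₀ (by positivity), mul_comm]
    refine le_trans ?_ (hd (ε, z))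
    gcongr
    exact norm_snd_le ((ε, z) : 𝕜 × E)
  have meas : ∀ {W : 𝕜 × E → 𝕜}, IsSchwartz W → ∀ ε,
      AEStronglyMeasurable (fun z => W (ε, z)) μ := fun hW ε =>
    (hW.continuous.comp (by fun_prop : Continuous fun z : E => (ε, z))).aestronglyMeasurable
  have hU0 : (fun ε => ∫ z, u ε z ∂μ) =ᶠ[𝓝 0] fun ε => ∫ z, U (ε, z) ∂μ := by
    filter_upwards [Metric.ball_mem_nhds (0 : 𝕜) one_pos] with ε hε
    simp only [(h ε hε _).1]
  have hV0 : ∫ z, v 0 z ∂μ = ∫ z, V (0, z) ∂μ := by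
    simp only [(h 0 (by simp) _).2.1]
  rw [hV0]
  refine HasDerivAt.congr_of_eventuallyEq ?_ hU0
  obtain ⟨C₁, h₁⟩ := decay hU
  obtain ⟨C₂, h₂⟩ := decay hV
  refine (hasDerivAt_integral_of_dominated_loc_of_deriv_le (s := Metric.ball (0 : 𝕜) 1)
    (bound := fun z => C₂ * (1 + ‖z‖) ^ (-(μ.integrablePower : ℝ)))
    (F := fun ε z => U (ε, z)) (F' := fun ε z => V (ε, z))
    (Metric.ball_mem_nhds _ one_pos) (Eventually.of_forall fun ε => meas hU ε) ?_ (meas hV 0)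
    (Eventually.of_forall fun z ε _ => h₂ ε z)
    ((Measure.integrable_pow_neg_integrablePower μ).const_mul _) ?_).2
  · exact ((Measure.integrable_pow_neg_integrablePower μ).const_mul C₁).mono' (meas hU 0)
      (Eventually.of_forall fun z => h₁ 0 z)
  · refine Eventually.of_forall fun z ε hε => ?_
    rw [(h ε hε _).2.1]
    exact (h ε hε _).2.2.2

/-- The derivatives in ε and in z are exchanged by the symmetry of the second derivative of the
joint function U. -/
theorem fderiv_apply (h : IsSchwartzCurve u v) (d : E) :
    IsSchwartzCurve (fun ε z => fderiv ℝ (u ε) z d) (fun ε z => fderiv ℝ (v ε) z d) := by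
  obtain ⟨U, V, hU, hV, h⟩ := h.exists_schwartz
  have hu : ∀ ε ∈ Metric.ball (0 : 𝕜) 1, ∀ z, fderiv ℝ U (ε, z) (0, d) = fderiv ℝ (u ε) z d := by
    intro ε hε z
    rw [← funext fun z => (h ε hε z).1, (hasFDerivAt_slice hU.differentiable ε z).fderiv]
    simp
  refine ⟨fun x => fderiv ℝ U x (0, d), hU.fderiv_apply _, fun ε hε z => ⟨hu ε hε z, ?_⟩⟩
  have he : ∀ᶠ η in 𝓝 ε, fderiv ℝ (u η) z d = fderiv ℝ U (η, z) (0, d) :=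
    Filter.mem_of_superset (Metric.isOpen_ball.mem_nhds hε) fun η hη => (hu η hη z).symm
  refine HasDerivAt.congr_of_eventuallyEq ?_ he
  rw [hasDerivAt_iff_hasFDerivAt]
  have hd2 : HasFDerivAt (fderiv ℝ U) (fderiv ℝ (fderiv ℝ U) (ε, z)) (ε, z) :=
    (hU.fderiv.differentiable _).hasFDerivAt
  have hG : HasFDerivAt (fun ε => fderiv ℝ U (ε, z) (0, d))
      ((ContinuousLinearMap.apply ℝ 𝕜 ((0, d) : 𝕜 × E)).comp
        ((fderiv ℝ (fderiv ℝ U) (ε, z)).comp (.inl ℝ 𝕜 E))) ε :=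
    (ContinuousLinearMap.apply ℝ 𝕜 ((0, d) : 𝕜 × E)).hasFDerivAt.comp ε
      (hd2.comp ε (hasFDerivAt_prodMk_left ε z))
  -- Symmetry yields only a real derivative in ε. It is a derivative over 𝕜 because it agrees with
  -- the 𝕜-linear map η ↦ η ∂_d v.
  refine hasFDerivAt_of_restrictScalars ℝ hG ?_
  ext η
  have hs : fderiv ℝ (fderiv ℝ U) (ε, z) (η, 0) (0, d) =
      fderiv ℝ (fderiv ℝ U) (ε, z) (0, d) (η, 0) :=
    ((contDiff_infty.1 hU.contDiff 2).contDiffAt.isSymmSndFDerivAt (by simp)).eq _ _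
  have h1 := ((ContinuousLinearMap.apply ℝ 𝕜 ((η, 0) : 𝕜 × E)).hasFDerivAt.comp z
    (hd2.comp z (hasFDerivAt_prodMk_right ε z))).fderiv
  have h2 : (fun z => fderiv ℝ U (ε, z) (η, 0)) = fun z => η * v ε z :=
    funext fun z => (h ε hε z).2.2.1 η
  have hv : DifferentiableAt ℝ (v ε) z := by
    rw [← funext fun z => (h ε hε z).2.1]
    exact (hasFDerivAt_slice hV.differentiable ε z).differentiableAt
  have h3 := congrArg (fun L => L d) h1
  rw [show (ContinuousLinearMap.apply ℝ 𝕜 ((η, 0) : 𝕜 × E) ∘ fderiv ℝ U ∘ fun f => (ε, f)) =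
    fun z => η * v ε z from h2, fderiv_const_mul hv] at h3
  simp only [smul_apply, smul_eq_mul] at h3
  simp only [ContinuousLinearMap.coe_restrictScalars', ContinuousLinearMap.toSpanSingleton_apply,
    ContinuousLinearMap.comp_apply, ContinuousLinearMap.inl_apply, smul_eq_mul, h3]
  simpa using hs.symm

end IsSchwartzCurve

/-- The cut-off χ(ε) is placed inside h: χ(ε)(f + εΦ) is Schwartz in (ε, z), and h preserves this
since h(0) = 0. The power of l + εm has temperate growth and needs no cut-off. -/
theorem isSchwartzCurve_comp_mul_pow {h : 𝕜 → 𝕜} (hh : ContDiff 𝕜 ∞ h) (h0 : h 0 = 0)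
    {f Φ l m : E → 𝕜} (hf : IsSchwartz f) (hΦ : IsSchwartz Φ) (hl : l.HasTemperateGrowth)
    (hm : m.HasTemperateGrowth) (n : ℕ) :
    IsSchwartzCurve (fun ε z => h (f z + ε * Φ z) * (l z + ε * m z) ^ n)
      (fun ε z => deriv h (f z + ε * Φ z) * Φ z * (l z + ε * m z) ^ n +
        h (f z + ε * Φ z) * (n * (l z + ε * m z) ^ (n - 1) * m z)) := by
  obtain ⟨χ, hχ, h1⟩ := exists_isSchwartz_eq_one 𝕜 𝕜
  have hW : IsSchwartz (fun x : 𝕜 × E => χ x.1 * f x.2 + χ x.1 * x.1 * Φ x.2) :=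
    (hχ.tensor hf).add ((hχ.mul_right Function.HasTemperateGrowth.id').tensor hΦ)
  have h2 : (fun x : 𝕜 × E => x.2).HasTemperateGrowth :=
    (ContinuousLinearMap.snd ℝ 𝕜 E).hasTemperateGrowth
  have h3 : (fun x : 𝕜 × E => x.1).HasTemperateGrowth :=
    (ContinuousLinearMap.fst ℝ 𝕜 E).hasTemperateGrowth
  have hlam : (fun x : 𝕜 × E => (l x.2 + x.1 * m x.2) ^ n).HasTemperateGrowth :=
    ((hl.comp h2).add (h3.mul (hm.comp h2))).pow n
  refine ⟨_, (hW.comp hh h0).mul_right hlam, fun ε hε z => ⟨?_, ?_⟩⟩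
  · simp only [h1 ε (Metric.ball_subset_closedBall hε), one_mul]
  · have a1 : HasDerivAt (fun ε => f z + ε * Φ z) (Φ z) ε := by
      simpa using ((hasDerivAt_id ε).mul_const (Φ z)).const_add (f z)
    have a2 : HasDerivAt (fun ε => l z + ε * m z) (m z) ε := by
      simpa using ((hasDerivAt_id ε).mul_const (m z)).const_add (l z)
    have a3 := ((hh.differentiable (by simp)) (f z + ε * Φ z)).hasDerivAt.comp ε a1
    exact a3.mul (a2.pow n)

end Curve

/-! ### Densities of the Hamiltonians and their derivatives -/

section Density

variable {𝕜 : Type*} [RCLike 𝕜] {E : Type} [NormedAddCommGroup E] [NormedSpace ℝ E]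

/-- `λ(z) = ℓ(z) + ⨍ f(z - s e) / s ds`. -/
def lineLam (e : E) (l : E →L[ℝ] ℝ) (f : E → 𝕜) (z : E) : 𝕜 :=
  (l z : 𝕜) + lineHilbert e f z

/-- The density `h(f) λ^n / n!`. -/
def density (e : E) (l : E →L[ℝ] ℝ) (h : 𝕜 → 𝕜) (n : ℕ) (f : E → 𝕜) (z : E) : 𝕜 :=
  1 / (n ! : 𝕜) * (h (f z) * lineLam e l f z ^ n)

/-- The derivative `n h(f) λ^(n-1) / n!` of the density with respect to `λ`. -/
def densityLam (e : E) (l : E →L[ℝ] ℝ) (h : 𝕜 → 𝕜) (n : ℕ) (f : E → 𝕜) (z : E) : 𝕜 :=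
  (n : 𝕜) / (n ! : 𝕜) * (h (f z) * lineLam e l f z ^ (n - 1))

/-- The variational derivative of `∫ h(f) λ^n / n!`. -/
def covector (e : E) (l : E →L[ℝ] ℝ) (h : 𝕜 → 𝕜) (n : ℕ) (f : E → 𝕜) (z : E) : 𝕜 :=
  density e l (deriv h) n f z - lineHilbert e (densityLam e l h n f) z

variable {e : E} (he : ‖e‖ = 1) (l : E →L[ℝ] ℝ) {h : 𝕜 → 𝕜} (hh : ContDiff 𝕜 ∞ h) (n : ℕ)
  {f Φ : E → 𝕜} (hf : IsSchwartz f) (hΦ : IsSchwartz Φ)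

/-- The mechanism of the recursion: differentiation in λ lowers the level by one. -/
theorem densityLam_succ (e : E) (h : 𝕜 → 𝕜) (f : E → 𝕜) :
    densityLam e l h (n + 1) f = density e l h n f := by
  ext z
  have : (n ! : 𝕜) ≠ 0 := by exact_mod_cast n.factorial_ne_zero
  have : (n : 𝕜) + 1 ≠ 0 := by exact_mod_cast n.succ_ne_zero
  simp only [densityLam, density, Nat.add_sub_cancel, Nat.factorial_succ]
  push_cast
  field_simp

include he hf in
theorem lineLam_hasTemperateGrowth : (lineLam e l f).HasTemperateGrowth :=
  ((Function.RCLike.hasTemperateGrowth_ofReal (𝕜 := 𝕜)).comp l.hasTemperateGrowth).add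
    (hf.lineHilbert he)

include he hh hf in
theorem density_hasTemperateGrowth : (density e l h n f).HasTemperateGrowth :=
  (Function.HasTemperateGrowth.const _).mul
    ((hf.hasTemperateGrowth_comp hh).mul ((lineLam_hasTemperateGrowth he l hf).pow n))

include he hh hf in
theorem isSchwartz_density (h0 : h 0 = 0) : IsSchwartz (density e l h n f) :=
  ((hf.comp hh h0).mul_right ((lineLam_hasTemperateGrowth he l hf).pow n)).const_mul _

include he hh hf in
theorem isSchwartz_densityLam (h0 : h 0 = 0) : IsSchwartz (densityLam e l h n f) :=
  ((hf.comp hh h0).mul_right ((lineLam_hasTemperateGrowth he l hf).pow (n - 1))).const_mul _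

include he hh hf in
theorem densityLam_hasTemperateGrowth : (densityLam e l h n f).HasTemperateGrowth :=
  (Function.HasTemperateGrowth.const _).mul
    ((hf.hasTemperateGrowth_comp hh).mul ((lineLam_hasTemperateGrowth he l hf).pow (n - 1)))

include he hh hf in
theorem covector_hasTemperateGrowth (h0 : h 0 = 0) : (covector e l h n f).HasTemperateGrowth :=
  (density_hasTemperateGrowth he l (contDiff_deriv hh) n hf).sub
    ((isSchwartz_densityLam he l hh n hf h0).lineHilbert he)

theorem _root_.Function.HasTemperateGrowth.hasFDerivAt {F : Type*} [NormedAddCommGroup F]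
    [NormedSpace ℝ F] {u : E → F} (hu : u.HasTemperateGrowth) (z : E) :
    HasFDerivAt u (fderiv ℝ u z) z :=
  (hu.1.differentiable (by simp) z).hasFDerivAt

/-- The directional derivative of a product. -/
theorem fderiv_mul_apply' {u v : E → 𝕜} (hu : u.HasTemperateGrowth) (hv : v.HasTemperateGrowth)
    (z d : E) : fderiv ℝ (fun z => u z * v z) z d =
      u z * fderiv ℝ v z d + v z * fderiv ℝ u z d := by
  rw [((hu.hasFDerivAt z).fun_mul (hv.hasFDerivAt z)).fderiv]
  simp

theorem fderiv_sub_apply' {u v : E → 𝕜} (hu : u.HasTemperateGrowth) (hv : v.HasTemperateGrowth)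
    (z d : E) : fderiv ℝ (fun z => u z - v z) z d = fderiv ℝ u z d - fderiv ℝ v z d := by
  rw [((hu.hasFDerivAt z).fun_sub (hv.hasFDerivAt z)).fderiv]
  simp

theorem fderiv_add_apply' {u v : E → 𝕜} (hu : u.HasTemperateGrowth) (hv : v.HasTemperateGrowth)
    (z d : E) : fderiv ℝ (fun z => u z + v z) z d = fderiv ℝ u z d + fderiv ℝ v z d := by
  rw [((hu.hasFDerivAt z).fun_add (hv.hasFDerivAt z)).fderiv]
  simp

theorem _root_.Function.HasTemperateGrowth.fderiv_apply {u : E → 𝕜} (hu : u.HasTemperateGrowth)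
    (d : E) : (fun z => _root_.fderiv ℝ u z d).HasTemperateGrowth := by
  have h1 : (fderiv ℝ u).HasTemperateGrowth := by
    refine ⟨(contDiff_infty_iff_fderiv.1 hu.1).2, fun n => ?_⟩
    obtain ⟨k, C, hC⟩ := hu.2 (n + 1)
    exact ⟨k, C, fun z => by rw [norm_iteratedFDeriv_fderiv]; exact hC z⟩
  exact (ContinuousLinearMap.apply ℝ 𝕜 d).hasTemperateGrowth.comp h1

theorem fderiv_fderiv_comm {u : E → 𝕜} (hu : u.HasTemperateGrowth) (z a b : E) :
    fderiv ℝ (fun z => fderiv ℝ u z a) z b = fderiv ℝ (fun z => fderiv ℝ u z b) z a := by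
  have hd : HasFDerivAt (fderiv ℝ u) (fderiv ℝ (fderiv ℝ u) z) z :=
    ((contDiff_infty_iff_fderiv.1 hu.1).2.differentiable (by simp) z).hasFDerivAt
  have key : ∀ d, fderiv ℝ (fun z => fderiv ℝ u z d) z =
      (ContinuousLinearMap.apply ℝ 𝕜 d).comp (fderiv ℝ (fderiv ℝ u) z) := fun d =>
    ((ContinuousLinearMap.apply ℝ 𝕜 d).hasFDerivAt.comp z hd).fderiv
  rw [key, key]
  exact ((contDiff_infty.1 hu.1 2).contDiffAt.isSymmSndFDerivAt (by simp)).eq _ _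

include he hf in
theorem hasFDerivAt_lineLam (z : E) : HasFDerivAt (lineLam e l f)
    ((RCLike.ofRealCLM (K := 𝕜)).comp l + lineHilbert e (fderiv ℝ f) z) z :=
  ((RCLike.ofRealCLM (K := 𝕜)).comp l).hasFDerivAt.add (hasFDerivAt_lineHilbert he hf z)

include he hf in
theorem fderiv_lineLam (z d : E) : fderiv ℝ (lineLam e l f) z d =
    (l d : 𝕜) + lineHilbert e (fun z => fderiv ℝ f z d) z := by
  rw [(hasFDerivAt_lineLam he l hf z).fderiv, ← fderiv_lineHilbert_apply he hf,
    fderiv_lineHilbert he hf]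
  simp

include he hh hf in
theorem fderiv_density (z d : E) : fderiv ℝ (density e l h n f) z d =
    density e l (deriv h) n f z * fderiv ℝ f z d +
      densityLam e l h n f z * fderiv ℝ (lineLam e l f) z d := by
  have h1 := hasFDerivAt_comp_of_contDiff hh (hf.differentiable z).hasFDerivAt
  have h2 := (lineLam_hasTemperateGrowth he l hf).hasFDerivAt z
  have h3 := (h1.fun_mul (h2.pow n)).const_mul (1 / (n ! : 𝕜))
  rw [show density e l h n f = fun z => 1 / (n ! : 𝕜) * (h (f z) * lineLam e l f z ^ n) from rfl]
  rw [HasFDerivAt.fderiv h3]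
  simp [density, densityLam]
  ring

theorem lineLam_add_mul (he : ‖e‖ = 1) (hf : IsSchwartz f) (hΦ : IsSchwartz Φ) (ε : 𝕜) (z : E) :
    lineLam e l (fun z => f z + ε * Φ z) z = lineLam e l f z + ε * lineHilbert e Φ z := by
  rw [lineLam, lineLam, lineHilbert_add he hf (hΦ.const_mul ε), lineHilbert_const_mul, add_assoc]

include he hh hf hΦ in
theorem hasDerivAt_density (ε : 𝕜) (z : E) :
    HasDerivAt (fun ε => density e l h n (fun z => f z + ε * Φ z) z)
      (density e l (deriv h) n (fun z => f z + ε * Φ z) z * Φ z +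
        densityLam e l h n (fun z => f z + ε * Φ z) z * lineHilbert e Φ z) ε := by
  simp only [density, densityLam, lineLam_add_mul l he hf hΦ]
  have a1 : HasDerivAt (fun ε => f z + ε * Φ z) (Φ z) ε := by
    simpa using ((hasDerivAt_id ε).mul_const (Φ z)).const_add (f z)
  have a2 : HasDerivAt (fun ε => lineLam e l f z + ε * lineHilbert e Φ z)
      (lineHilbert e Φ z) ε := by
    simpa using ((hasDerivAt_id ε).mul_const (lineHilbert e Φ z)).const_add (lineLam e l f z)
  have a3 := ((hh.differentiable (by simp)) (f z + ε * Φ z)).hasDerivAt.comp ε a1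
  refine ((a3.fun_mul (a2.fun_pow n)).const_mul (1 / (n ! : 𝕜))).congr_deriv ?_
  simp only [Function.comp_def]
  ring

include he hh hf hΦ in
theorem isSchwartzCurve_density (h0 : h 0 = 0) :
    IsSchwartzCurve (fun ε => density e l h n (fun z => f z + ε * Φ z))
      (fun ε z => density e l (deriv h) n (fun z => f z + ε * Φ z) z * Φ z +
        densityLam e l h n (fun z => f z + ε * Φ z) z * lineHilbert e Φ z) := by
  obtain ⟨U, hU, h1⟩ := isSchwartzCurve_comp_mul_pow hh h0 hf hΦ
    (lineLam_hasTemperateGrowth he l hf) (hΦ.lineHilbert he) n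
  refine ⟨_, hU.const_mul (1 / (n ! : 𝕜)), fun ε hε z =>
    ⟨?_, hasDerivAt_density he l hh n hf hΦ ε z⟩⟩
  simp only [(h1 ε hε z).1, density, lineLam_add_mul l he hf hΦ]

include he hh hf hΦ in
-- At level n+1 the nonlocal part of the covector is P of the density at level n, and the density
-- itself is a Schwartz curve, so P may be differentiated along it.
theorem hasDerivAt_covector_succ (h0 : h 0 = 0) (z : E) :
    HasDerivAt (fun ε => covector e l h (n + 1) (fun z => f z + ε * Φ z) z)
      (density e l (deriv (deriv h)) (n + 1) f z * Φ z +
        density e l (deriv h) n f z * lineHilbert e Φ z -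
        lineHilbert e (fun z => density e l (deriv h) n f z * Φ z +
          densityLam e l h n f z * lineHilbert e Φ z) z) 0 := by
  have h1 := hasDerivAt_density he l (contDiff_deriv hh) (n + 1) hf hΦ 0 z
  have h2 := (isSchwartzCurve_density he l hh n hf hΦ h0).hasDerivAt_lineHilbert he z
  simp only [zero_mul, add_zero] at h1 h2
  rw [densityLam_succ] at h1
  simp only [covector, densityLam_succ]
  exact h1.sub h2

include he hh hf in
theorem fderiv_covector_succ (h0 : h 0 = 0) (z d : E) :
    fderiv ℝ (covector e l h (n + 1) f) z d =
      density e l (deriv (deriv h)) (n + 1) f z * fderiv ℝ f z d +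
        density e l (deriv h) n f z * fderiv ℝ (lineLam e l f) z d -
        fderiv ℝ (lineHilbert e (density e l h n f)) z d := by
  rw [show covector e l h (n + 1) f = fun z => density e l (deriv h) (n + 1) f z -
      lineHilbert e (density e l h n f) z by
    ext z
    rw [covector, densityLam_succ],
    fderiv_sub_apply' (density_hasTemperateGrowth he l (contDiff_deriv hh) (n + 1) hf)
      ((isSchwartz_density he l hh n hf h0).lineHilbert he),
    fderiv_density he l (contDiff_deriv hh) (n + 1) hf, densityLam_succ]

include he hh in
-- The variation of the density is αΦ + β PΦ; antisymmetry moves P from Φ to β. A general space E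
-- covers both the functionals on the line and their integrals over x.
theorem hasVarDensity_integral_density [MeasureSpace E] [BorelSpace E]
    [SecondCountableTopology E] [(volume : Measure E).IsAddRightInvariant]
    [(volume : Measure E).HasTemperateGrowth] [SFinite (volume : Measure E)] (h0 : h 0 = 0)
    (f : 𝓢(E, 𝕜)) :
    HasVarDensity (fun f : 𝓢(E, 𝕜) => ∫ z, density e l h n f z) f (covector e l h n f) := by
  have hf := isSchwartz f
  refine ⟨covector_hasTemperateGrowth he l hh n hf h0, fun Φ => ?_⟩
  have hΦ := isSchwartz Φ
  refine ((isSchwartzCurve_density he l hh n hf hΦ h0).hasDerivAt_integral volume).congr_deriv ?_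
  have hb := isSchwartz_densityLam he l hh n hf h0
  have ha := density_hasTemperateGrowth he l (contDiff_deriv hh) n hf
  have i1 : Integrable (fun z => density e l (deriv h) n f z * Φ z) :=
    (hΦ.mul_left ha).integrable
  have i2 : Integrable (fun z => densityLam e l h n f z * lineHilbert e Φ z) :=
    (hb.mul_right (hΦ.lineHilbert he)).integrable
  have i3 : Integrable (fun z => lineHilbert e (densityLam e l h n f) z * Φ z) :=
    (hΦ.mul_left (hb.lineHilbert he)).integrable
  simp only [zero_mul, add_zero, covector, sub_mul]
  rw [integral_add i1 i2, integral_sub i1 i3, integral_mul_lineHilbert volume he hb hΦ,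
    sub_eq_add_neg]

end Density

/-! ### Continuity of the principal value and of evaluation -/

section Functionals

variable {𝕜 : Type*} [RCLike 𝕜] {E : Type*} [NormedAddCommGroup E] [NormedSpace ℝ E]

/-- Evaluation at a point, as a tempered distribution. -/
def evalAt (z : E) : 𝓢(E, 𝕜) →L[𝕜] 𝕜 :=
  mkCLMtoNormedSpace (fun u => u z) (fun _ _ => rfl) (fun _ _ => rfl)
    ⟨{(0, 0)}, 1, zero_le_one, fun u => by simpa using norm_le_seminorm 𝕜 u z⟩

@[simp] theorem evalAt_apply (z : E) (u : 𝓢(E, 𝕜)) : evalAt z u = u z := rfl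

/-- The principal value at a point, as a tempered distribution. -/
def lineHilbertCLM (e : E) (he : ‖e‖ = 1) (z : E) : 𝓢(E, 𝕜) →L[𝕜] 𝕜 :=
  mkCLMtoNormedSpace (fun u => lineHilbert e u z)
    (fun u v => lineHilbert_add he (isSchwartz u) (isSchwartz v) z)
    (fun c u => lineHilbert_smul e c u z)
    -- The constant 4Cπ of `norm_lineHilbert_le`, with C twice the supremum of the seminorms up to
    -- order (1, 1).
    ⟨Finset.Iic (1, 1), 8 * Real.pi * (1 + ‖z‖), by positivity, fun u => by
      have h : ∀ i ≤ 1, ∀ z, (1 + ‖z‖) ^ 1 * ‖iteratedFDeriv ℝ i u z‖ ≤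
          2 ^ 1 * (Finset.Iic (1, 1)).sup (schwartzSeminormFamily 𝕜 E 𝕜) u := fun i hi z =>
        one_add_le_sup_seminorm_apply (𝕜 := 𝕜) (m := (1, 1)) le_rfl hi u z
      have h1 := h 1 le_rfl
      refine (norm_lineHilbert_le he u.differentiable
        (C := 2 ^ 1 * (Finset.Iic (1, 1)).sup (schwartzSeminormFamily 𝕜 E 𝕜) u)
        (fun z => by simpa only [pow_one, norm_iteratedFDeriv_zero] using h 0 zero_le_one z)
        (fun z => ?_) z).trans (le_of_eq (by ring))
      refine le_trans ?_ (h1 z)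
      rw [norm_iteratedFDeriv_one]
      exact le_mul_of_one_le_left (norm_nonneg _) (by simp)⟩

@[simp] theorem lineHilbertCLM_apply (e : E) (he : ‖e‖ = 1) (z : E) (u : 𝓢(E, 𝕜)) :
    lineHilbertCLM e he z u = lineHilbert e u z := rfl

end Functionals

/-! ### The hierarchy in one variable -/

section Line

variable {𝕜 : Type*} [RCLike 𝕜] {h : 𝕜 → 𝕜} (hh : ContDiff 𝕜 ∞ h) (h0 : h 0 = 0) (n : ℕ)
  (f Φ : 𝓢(ℝ, 𝕜))

theorem lam_eq_lineLam : lam f = lineLam 1 (.id ℝ ℝ) f := by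
  ext p
  rw [lam, lineLam, pv_eq_lineHilbert (isSchwartz f)]
  rfl

theorem H_eq_integral_density (h : 𝕜 → 𝕜) :
    H h n = fun f : 𝓢(ℝ, 𝕜) => ∫ p, density 1 (.id ℝ ℝ) h n f p := by
  ext f
  rw [H, ← integral_const_mul, lam_eq_lineLam]
  rfl

include hh h0

theorem hasVarDensity_H : HasVarDensity (H h n) f (covector 1 (.id ℝ ℝ) h n f) := by
  rw [H_eq_integral_density]
  exact hasVarDensity_integral_density norm_one _ hh n h0 f

theorem dH_eq_covector : dH h n f = covector 1 (.id ℝ ℝ) h n f :=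
  (Classical.epsilon_spec (p := HasVarDensity (H h n) f) ⟨_, hasVarDensity_H hh h0 n f⟩).unique
    (hasVarDensity_H hh h0 n f)

theorem integrable_comp_mul_lam_pow : Integrable (fun p => h (f p) * lam f p ^ n) := by
  rw [lam_eq_lineLam]
  exact (((isSchwartz f).comp hh h0).mul_right
    ((lineLam_hasTemperateGrowth norm_one _ (isSchwartz f)).pow n)).integrable

/-- The coefficient n/n! is 1/(n-1)! for n ≥ 1 and zero for n = 0, where the exponent n - 1 is
truncated; thus the first term is absent there. -/
theorem X_eq (p : ℝ) : X h n f p =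
    ((n : 𝕜) / (n ! : 𝕜) * pv (fun q => h (f q) * lam f q ^ (n - 1)) p
      - 1 / (n ! : 𝕜) * deriv h (f p) * lam f p ^ n) * deriv f p := by
  rw [X, raise, dH_eq_covector hh h0, covector, pv_eq_lineHilbert, lam_eq_lineLam]
  · rw [show densityLam (1 : ℝ) (.id ℝ ℝ) h n f = fun q => (n : 𝕜) / (n ! : 𝕜) *
      (h (f q) * lineLam 1 (.id ℝ ℝ) f q ^ (n - 1)) from rfl, lineHilbert_const_mul, density]
    ring
  · rw [lam_eq_lineLam]
    exact ((isSchwartz f).comp hh h0).mul_right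
      ((lineLam_hasTemperateGrowth norm_one _ (isSchwartz f)).pow (n - 1))

/-- The operator of multiplication by `X_{h,n}`, after cancellation by the product formula. -/
theorem V_eq (p : ℝ) : V h n f Φ p =
    density 1 (.id ℝ ℝ) (deriv h) n f p *
        (fderiv ℝ (lineLam 1 (.id ℝ ℝ) f) p 1 * Φ p - fderiv ℝ f p 1 * lineHilbert 1 Φ p)
      - Φ p * fderiv ℝ (lineHilbert 1 (density 1 (.id ℝ ℝ) h n f)) p 1
      + fderiv ℝ f p 1 * lineHilbert 1 (fun q => density 1 (.id ℝ ℝ) (deriv h) n f q * Φ q +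
          densityLam 1 (.id ℝ ℝ) h n f q * lineHilbert 1 Φ q) p := by
  obtain ⟨c, hc⟩ := exists_lineHilbert_mul_lineHilbert 𝕜
  have hf := isSchwartz f
  have hΦ := isSchwartz Φ
  have hf' : IsSchwartz (fun q => fderiv ℝ f q 1) := hf.fderiv_apply 1
  have hb := isSchwartz_densityLam (E := ℝ) norm_one (.id ℝ ℝ) hh n hf h0
  have ha := density_hasTemperateGrowth (E := ℝ) norm_one (.id ℝ ℝ) (contDiff_deriv hh) n hf
  have hk := covector_hasTemperateGrowth (E := ℝ) norm_one (.id ℝ ℝ) hh n hf h0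
  have hP : ∀ {u : ℝ → 𝕜}, IsSchwartz u → (lineHilbert (1 : ℝ) u).HasTemperateGrowth :=
    fun hu => hu.lineHilbert norm_one
  have e1 : lineHilbert 1 (fun q => -covector 1 (.id ℝ ℝ) h n f q * Φ q) p =
      lineHilbert 1 (fun q => Φ q * lineHilbert 1 (densityLam 1 (.id ℝ ℝ) h n f) q) p -
        lineHilbert 1 (fun q => density 1 (.id ℝ ℝ) (deriv h) n f q * Φ q) p := by
    rw [← lineHilbert_sub norm_one (hΦ.mul_right (hP hb)) (hΦ.mul_left ha)]
    congr 1
    ext q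
    rw [covector]
    ring
  have e2 : lineHilbert 1 (raise f (covector 1 (.id ℝ ℝ) h n f)) p =
      lineHilbert 1 (fun q => fderiv ℝ f q 1 *
        lineHilbert 1 (densityLam 1 (.id ℝ ℝ) h n f) q) p -
        lineHilbert 1 (fun q => density 1 (.id ℝ ℝ) (deriv h) n f q * fderiv ℝ f q 1) p := by
    rw [← lineHilbert_sub norm_one (hf'.mul_right (hP hb)) (hf'.mul_left ha)]
    congr 1
    ext q
    rw [raise, covector, fderiv_apply_one_eq_deriv]
    ring
  have hdens : IsSchwartz (density 1 (.id ℝ ℝ) h n f) := isSchwartz_density norm_one _ hh n hf h0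
  -- P commutes with d/dp, and λ' = 1 + Pf'; the 1 is what produces the separate term Pβ.
  have e3 : fderiv ℝ (lineHilbert 1 (density 1 (.id ℝ ℝ) h n f)) p 1 =
      lineHilbert 1 (fun q => density 1 (.id ℝ ℝ) (deriv h) n f q * fderiv ℝ f q 1) p +
        (lineHilbert 1 (densityLam 1 (.id ℝ ℝ) h n f) p +
        lineHilbert 1 (fun q => densityLam 1 (.id ℝ ℝ) h n f q *
          lineHilbert 1 (fun q => fderiv ℝ f q 1) q) p) := by
    rw [fderiv_lineHilbert_apply norm_one hdens, ← lineHilbert_add norm_one hb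
      (hb.mul_right (hP hf')), ← lineHilbert_add norm_one (hf'.mul_left ha)
      (hb.add (hb.mul_right (hP hf')))]
    congr 1
    ext q
    rw [fderiv_density norm_one _ hh n hf, fderiv_lineLam norm_one _ hf]
    simp only [ContinuousLinearMap.id_apply, RCLike.ofReal_one]
    ring
  have e4 : lineHilbert 1 (fun q => density 1 (.id ℝ ℝ) (deriv h) n f q * Φ q +
          densityLam 1 (.id ℝ ℝ) h n f q * lineHilbert 1 Φ q) p =
      lineHilbert 1 (fun q => density 1 (.id ℝ ℝ) (deriv h) n f q * Φ q) p +
        lineHilbert 1 (fun q => densityLam 1 (.id ℝ ℝ) h n f q * lineHilbert 1 Φ q) p :=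
    lineHilbert_add norm_one (hΦ.mul_left ha) (hb.mul_right (hP hΦ)) p
  have e5 := fderiv_lineLam norm_one (.id ℝ ℝ) hf p 1
  have c1 := hc _ _ hb hΦ p
  have c2 := hc _ _ hb hf' p
  rw [V, mulOp, dH_eq_covector hh h0, pv_eq_lineHilbert hΦ, pv_eq_lineHilbert,
    pv_eq_lineHilbert, e1, e2, e3, e4, lam_eq_lineLam, ← fderiv_apply_one_eq_deriv,
    ← fderiv_apply_one_eq_deriv, raise, covector, ← fderiv_apply_one_eq_deriv, e5]
  · simp only [ContinuousLinearMap.id_apply, RCLike.ofReal_one]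
    -- The product formula for (β, Φ) is weighted by f' and that for (β, f') by Φ; both carry c β
    -- f'Φ, which cancels.
    linear_combination (fderiv ℝ f p 1) * c1 - Φ p * c2
  · have : raise f (covector 1 (.id ℝ ℝ) h n f) =
        fun q => -(fderiv ℝ f q 1 * covector 1 (.id ℝ ℝ) h n f q) := by
      ext q
      rw [raise, fderiv_apply_one_eq_deriv, neg_mul]
    rw [this]
    exact (hf'.mul_right hk).neg
  · have : (fun q => -covector 1 (.id ℝ ℝ) h n f q * Φ q) =
        fun q => -(covector 1 (.id ℝ ℝ) h n f q * Φ q) := by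
      ext q
      rw [neg_mul]
    rw [this]
    exact (hΦ.mul_left hk).neg

omit f Φ in
theorem exists_hasCovDeriv (f : 𝓢(ℝ, 𝕜)) (p : ℝ) : ∃ T : 𝓢(ℝ, 𝕜) →L[𝕜] 𝕜,
    HasCovDeriv (dH h (n + 1)) f p T ∧ ∀ Φ : 𝓢(ℝ, 𝕜), T Φ = V h n f Φ p := by
  have hf := isSchwartz f
  set k := covector 1 (.id ℝ ℝ) h n f with hk
  have hkt : k.HasTemperateGrowth := covector_hasTemperateGrowth norm_one _ hh n hf h0
  -- The multiplication operator as defined, before the product formula, is visibly a combination of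
  -- continuous functionals.
  let T : 𝓢(ℝ, 𝕜) →L[𝕜] 𝕜 :=
    raise f k p • lineHilbertCLM 1 norm_one p
      + deriv f p • (lineHilbertCLM 1 norm_one p).comp (smulLeftCLM 𝕜 k)
      + (pv (raise f k) p + deriv (lam f) p * k p) • evalAt p
  have hT : ∀ Φ : 𝓢(ℝ, 𝕜), T Φ = V h n f Φ p := fun Φ => by
    have hs : IsSchwartz (fun q => k q * Φ q) := (isSchwartz Φ).mul_left hkt
    have e1 : (fun q => -k q * Φ q) = fun q => -(k q * Φ q) := by
      ext q
      rw [neg_mul]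
    rw [V, mulOp, dH_eq_covector hh h0, ← hk, e1, pv_eq_lineHilbert (isSchwartz Φ),
      pv_eq_lineHilbert hs.neg, lineHilbert_neg]
    have e2 : (smulLeftCLM 𝕜 k Φ : ℝ → 𝕜) = fun q => k q * Φ q :=
      funext fun q => smulLeftCLM_apply_apply hkt Φ q
    simp only [T, add_apply, smul_apply, ContinuousLinearMap.comp_apply, lineHilbertCLM_apply,
      evalAt_apply, smul_eq_mul, e2]
    ring
  set k' := covector 1 (.id ℝ ℝ) h (n + 1) f with hk'
  have hkt' : k'.HasTemperateGrowth := covector_hasTemperateGrowth norm_one _ hh (n + 1) hf h0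
  have hch : ∀ Φ : 𝓢(ℝ, 𝕜), christoffelTerm k' Φ p =
      k' p * deriv Φ p + deriv k' p * Φ p := fun Φ => by
    have e1 : (fun q => -k' q * Φ q) = fun q => -(k' q * Φ q) := by
      ext q
      rw [neg_mul]
    rw [christoffelTerm, e1, deriv.fun_neg, neg_neg]
    have := fderiv_mul_apply' hkt' Φ.hasTemperateGrowth p 1
    simp only [fderiv_apply_one_eq_deriv] at this
    rw [this]
    ring
  -- D is defined as the difference of T and the Christoffel term. What remains to be shown is that
  -- it is the variational derivative of X.
  let D : 𝓢(ℝ, 𝕜) →L[𝕜] 𝕜 := T - (k' p • (evalAt p).comp (derivCLM 𝕜 𝕜) + deriv k' p • evalAt p)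
  have hD : ∀ Φ : 𝓢(ℝ, 𝕜), D Φ = V h n f Φ p - (k' p * deriv Φ p + deriv k' p * Φ p) :=
    fun Φ => by
      simp only [D, sub_apply, add_apply, smul_apply, ContinuousLinearMap.comp_apply,
        evalAt_apply, smul_eq_mul, derivCLM_apply, hT]
  refine ⟨T, ⟨D, fun Φ => ?_, fun Φ => ?_⟩, hT⟩
  · have hΦ := isSchwartz Φ
    have a1 : HasDerivAt (fun ε : 𝕜 => -(deriv f p + ε * deriv Φ p)) (-deriv Φ p) 0 := by
      simpa using (((hasDerivAt_id' (0 : 𝕜)).mul_const (deriv Φ p)).const_add (deriv f p)).fun_neg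
    have a2 := hasDerivAt_covector_succ (E := ℝ) norm_one (.id ℝ ℝ) hh n hf hΦ h0 p
    have a3 := a1.fun_mul a2
    have e1 : (fun ε : 𝕜 => raise (f + ε • Φ) (dH h (n + 1) (f + ε • Φ)) p) =
        fun ε : 𝕜 => -(deriv f p + ε * deriv Φ p) *
          covector 1 (.id ℝ ℝ) h (n + 1) (fun z => f z + ε * Φ z) p := by
      ext ε
      rw [raise, dH_eq_covector hh h0]
      congr 2
      have := (f.hasDerivAt p).add ((Φ.hasDerivAt p).const_mul ε)
      exact this.deriv
    rw [e1]
    refine a3.congr_deriv ?_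
    have e2 := fderiv_covector_succ norm_one (.id ℝ ℝ) hh n hf h0 p 1
    rw [fderiv_apply_one_eq_deriv] at e2
    rw [hD, V_eq hh h0, hk', e2]
    simp only [zero_mul, add_zero, fderiv_apply_one_eq_deriv]
    ring
  · rw [dH_eq_covector hh h0, ← hk', hch, hD, hT]
    ring

end Line

/-! ### Slices -/

section Slice

variable {𝕜 : Type*} [RCLike 𝕜]

theorem norm_zero_one : ‖((0, 1) : ℝ × ℝ)‖ = 1 := by simp [Prod.norm_def]

theorem slice_apply (f : 𝓢(ℝ × ℝ, 𝕜)) (x p : ℝ) : slice f x p = f (x, p) := rfl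

theorem IsSchwartz.slice {u : ℝ × ℝ → 𝕜} (hu : IsSchwartz u) (x : ℝ) :
    IsSchwartz (fun p => u (x, p)) := by
  obtain ⟨U, rfl⟩ := hu
  exact ⟨DKP.slice U x, rfl⟩

theorem lineHilbert_slice (u : ℝ × ℝ → 𝕜) (x : ℝ) :
    lineHilbert 1 (fun p => u (x, p)) = fun p => lineHilbert (0, 1) u (x, p) := by
  ext p
  simp [lineHilbert]

theorem lineLam_slice (u : ℝ × ℝ → 𝕜) (x : ℝ) : lineLam 1 (.id ℝ ℝ) (fun p => u (x, p)) =
    fun p => lineLam (0, 1) (.snd ℝ ℝ ℝ) u (x, p) := by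
  ext p
  rw [lineLam, lineHilbert_slice]
  rfl

theorem density_slice (h : 𝕜 → 𝕜) (n : ℕ) (u : ℝ × ℝ → 𝕜) (x : ℝ) :
    density 1 (.id ℝ ℝ) h n (fun p => u (x, p)) =
      fun p => density (0, 1) (.snd ℝ ℝ ℝ) h n u (x, p) := by
  ext p
  rw [density, lineLam_slice]
  rfl

theorem densityLam_slice (h : 𝕜 → 𝕜) (n : ℕ) (u : ℝ × ℝ → 𝕜) (x : ℝ) :
    densityLam 1 (.id ℝ ℝ) h n (fun p => u (x, p)) =
      fun p => densityLam (0, 1) (.snd ℝ ℝ ℝ) h n u (x, p) := by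
  ext p
  rw [densityLam, lineLam_slice]
  rfl

theorem fderiv_slice {u : ℝ × ℝ → 𝕜} (hu : u.HasTemperateGrowth) (x p : ℝ) :
    fderiv ℝ (fun p => u (x, p)) p 1 = fderiv ℝ u (x, p) (0, 1) := by
  have := (hu.hasFDerivAt (x, p)).comp p (hasFDerivAt_prodMk_right x p)
  rw [Function.comp_def] at this
  rw [this.fderiv]
  simp

/-- The product formula for principal values in the second variable. -/
theorem exists_lineHilbert_mul_lineHilbert_plane (𝕜 : Type*) [RCLike 𝕜] :
    ∃ c : 𝕜, ∀ u v : ℝ × ℝ → 𝕜, IsSchwartz u → IsSchwartz v → ∀ z,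
      lineHilbert (0, 1) u z * lineHilbert (0, 1) v z =
        lineHilbert (0, 1) (fun z => u z * lineHilbert (0, 1) v z) z
          + lineHilbert (0, 1) (fun z => v z * lineHilbert (0, 1) u z) z + c * (u z * v z) := by
  obtain ⟨c, hc⟩ := exists_lineHilbert_mul_lineHilbert 𝕜
  refine ⟨c, fun u v hu hv z => ?_⟩
  obtain ⟨x, p⟩ := z
  have := hc _ _ (hu.slice x) (hv.slice x) p
  simp only [lineHilbert_slice] at this
  rw [this]
  exact congrArg₂ (fun a b => a + b + c * (u (x, p) * v (x, p)))
    (congrFun (lineHilbert_slice (fun z => u z * lineHilbert (0, 1) v z) x) p)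
    (congrFun (lineHilbert_slice (fun z => v z * lineHilbert (0, 1) u z) x) p)

end Slice

/-! ### The canonical bracket -/

section Canonical

variable {𝕜 : Type*} [RCLike 𝕜]

/-- The canonical bracket `u_p v_x - u_x v_p`. -/
def poisson (u v : ℝ × ℝ → 𝕜) (z : ℝ × ℝ) : 𝕜 :=
  fderiv ℝ u z (0, 1) * fderiv ℝ v z (1, 0) - fderiv ℝ u z (1, 0) * fderiv ℝ v z (0, 1)

variable {u v : ℝ × ℝ → 𝕜}

theorem poisson_hasTemperateGrowth (hu : u.HasTemperateGrowth) (hv : v.HasTemperateGrowth) :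
    (poisson u v).HasTemperateGrowth :=
  ((hu.fderiv_apply _).mul (hv.fderiv_apply _)).sub ((hu.fderiv_apply _).mul (hv.fderiv_apply _))

theorem isSchwartz_poisson (hu : u.HasTemperateGrowth) (hv : IsSchwartz v) :
    IsSchwartz (poisson u v) :=
  ((hv.fderiv_apply _).mul_left (hu.fderiv_apply _)).sub
    ((hv.fderiv_apply _).mul_left (hu.fderiv_apply _))

theorem poisson_comm (u v : ℝ × ℝ → 𝕜) (z : ℝ × ℝ) : poisson u v z = -poisson v u z := by
  unfold poisson
  ring

theorem fderiv_poisson (hu : u.HasTemperateGrowth) (hv : v.HasTemperateGrowth) (z d : ℝ × ℝ) :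
    fderiv ℝ (poisson u v) z d =
      fderiv ℝ (fun z => fderiv ℝ u z (0, 1)) z d * fderiv ℝ v z (1, 0)
      + fderiv ℝ u z (0, 1) * fderiv ℝ (fun z => fderiv ℝ v z (1, 0)) z d
      - fderiv ℝ (fun z => fderiv ℝ u z (1, 0)) z d * fderiv ℝ v z (0, 1)
      - fderiv ℝ u z (1, 0) * fderiv ℝ (fun z => fderiv ℝ v z (0, 1)) z d := by
  rw [show poisson u v = fun z => fderiv ℝ u z (0, 1) * fderiv ℝ v z (1, 0) -
      fderiv ℝ u z (1, 0) * fderiv ℝ v z (0, 1) from rfl,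
    fderiv_sub_apply' ((hu.fderiv_apply _).fun_mul (hv.fderiv_apply _))
      ((hu.fderiv_apply _).fun_mul (hv.fderiv_apply _)),
    fderiv_mul_apply' (hu.fderiv_apply _) (hv.fderiv_apply _),
    fderiv_mul_apply' (hu.fderiv_apply _) (hv.fderiv_apply _)]
  ring

/-- The right-hand side of the flow, as a Hamiltonian equation. -/
def flowRHS (h : 𝕜 → 𝕜) (n : ℕ) (f : ℝ × ℝ → 𝕜) (z : ℝ × ℝ) : 𝕜 :=
  density (0, 1) (.snd ℝ ℝ ℝ) (deriv h) n f z * poisson (lineLam (0, 1) (.snd ℝ ℝ ℝ) f) f z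
    - poisson (lineHilbert (0, 1) (density (0, 1) (.snd ℝ ℝ ℝ) h n f)) f z

variable {h : 𝕜 → 𝕜} (hh : ContDiff 𝕜 ∞ h) (h0 : h 0 = 0) (n : ℕ)

include hh h0

/-- The coordinate p does not depend on x, so P f_x = λ_x. The argument of the outer principal value
in `V_eq` is then α f_x + β λ_x = a_x, and P commutes with ∂_x. -/
theorem flow_eq_flowRHS (f : 𝓢(ℝ × ℝ, 𝕜)) : flow h n f = flowRHS h n f := by
  ext ⟨x, p⟩
  have hf := isSchwartz f
  have hdens : IsSchwartz (density (0, 1) (.snd ℝ ℝ ℝ) h n f) :=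
    isSchwartz_density norm_zero_one _ hh n hf h0
  have e0 : (slice (∂_{((1, 0) : ℝ × ℝ)} f) x : ℝ → 𝕜) = fun q => fderiv ℝ f (x, q) (1, 0) := by
    ext q
    rw [slice_apply, lineDerivOp_apply_eq_fderiv]
  have e1 : (slice f x : ℝ → 𝕜) = fun q => f (x, q) := rfl
  have e2 : lineHilbert (0, 1) (fun z => fderiv ℝ f z (1, 0)) =
      fun z => fderiv ℝ (lineLam (0, 1) (.snd ℝ ℝ ℝ) f) z (1, 0) := by
    ext z
    rw [fderiv_lineLam norm_zero_one _ hf]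
    simp
  rw [flow, V_eq hh h0, e0, e1, lineHilbert_slice (fun z => fderiv ℝ f z (1, 0)), e2]
  simp only [density_slice, densityLam_slice, lineLam_slice]
  rw [lineHilbert_slice (density (0, 1) (.snd ℝ ℝ ℝ) h n f), fderiv_slice hf.hasTemperateGrowth,
    fderiv_slice (lineLam_hasTemperateGrowth norm_zero_one _ hf),
    fderiv_slice (hdens.lineHilbert norm_zero_one),
    lineHilbert_slice (fun z => density (0, 1) (.snd ℝ ℝ ℝ) (deriv h) n f z *
      fderiv ℝ f z (1, 0) + densityLam (0, 1) (.snd ℝ ℝ ℝ) h n f z *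
        fderiv ℝ (lineLam (0, 1) (.snd ℝ ℝ ℝ) f) z (1, 0))]
  simp only [← fderiv_density norm_zero_one _ hh n hf, ← fderiv_lineHilbert_apply norm_zero_one
    hdens]
  rw [flowRHS, poisson, poisson]
  ring

omit hh h0 in
theorem H_slice (f : 𝓢(ℝ × ℝ, 𝕜)) (x : ℝ) :
    H h n (slice f x) = ∫ p, density (0, 1) (.snd ℝ ℝ ℝ) h n f (x, p) := by
  rw [H_eq_integral_density]
  simp only [← density_slice]
  rfl

theorem integrable_H_slice (f : 𝓢(ℝ × ℝ, 𝕜)) : Integrable (fun x => H h n (slice f x)) := by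
  have hi : Integrable (density (0, 1) (.snd ℝ ℝ ℝ) h n f) (volume : Measure (ℝ × ℝ)) :=
    (isSchwartz_density norm_zero_one _ hh n (isSchwartz f) h0).integrable
  simp only [H_slice]
  exact hi.integral_prod_left

theorem totalH_eq :
    totalH h n = fun f : 𝓢(ℝ × ℝ, 𝕜) => ∫ z, density (0, 1) (.snd ℝ ℝ ℝ) h n f z := by
  ext f
  have hi : Integrable (density (0, 1) (.snd ℝ ℝ ℝ) h n f) (volume : Measure (ℝ × ℝ)) :=
    (isSchwartz_density norm_zero_one _ hh n (isSchwartz f) h0).integrable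
  simp only [totalH, H_slice]
  exact (integral_prod _ hi).symm

theorem hasVarDensity_totalH (f : 𝓢(ℝ × ℝ, 𝕜)) :
    HasVarDensity (totalH h n) f (covector (0, 1) (.snd ℝ ℝ ℝ) h n f) := by
  rw [totalH_eq hh h0]
  exact hasVarDensity_integral_density norm_zero_one _ hh n h0 f

/-- Evaluation at z is linear, so its variational derivative is the delta function at z. The mixed
second derivatives of k cancel in the pairing, leaving {k, f}; the part of ∇k parallel to ∇f drops
out. -/
theorem hasLPBracket_flow (f : 𝓢(ℝ × ℝ, 𝕜)) (z : ℝ × ℝ) :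
    HasLPBracket f (fun g => g z) (totalH h (n + 1)) (flow h n f z) := by
  have hf := isSchwartz f
  have hk := covector_hasTemperateGrowth norm_zero_one (.snd ℝ ℝ ℝ) hh (n + 1) hf h0
  refine ⟨evalAt z, _, fun Φ => ?_, hasVarDensity_totalH hh h0 (n + 1) f, ?_⟩
  · simpa using ((hasDerivAt_id (0 : 𝕜)).mul_const (Φ z)).const_add (f z)
  · have e : ∀ a b : ℝ × ℝ, evalAt z (∂_{a} (smulLeftCLM 𝕜
        (fun z => fderiv ℝ (covector (0, 1) (.snd ℝ ℝ ℝ) h (n + 1) f) z b) f)) =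
        fderiv ℝ (covector (0, 1) (.snd ℝ ℝ ℝ) h (n + 1) f) z b * fderiv ℝ f z a +
        f z * fderiv ℝ (fun z => fderiv ℝ (covector (0, 1) (.snd ℝ ℝ ℝ) h (n + 1) f) z b) z a := by
      intro a b
      rw [evalAt_apply, lineDerivOp_apply_eq_fderiv,
        ← fderiv_mul_apply' (hk.fderiv_apply b) hf.hasTemperateGrowth]
      congr 2
      ext z
      exact smulLeftCLM_apply_apply (hk.fderiv_apply b) f z
    rw [bracketPairing, e, e, fderiv_fderiv_comm hk z (0, 1) (1, 0), flow_eq_flowRHS hh h0,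
      fderiv_covector_succ norm_zero_one _ hh n hf h0,
      fderiv_covector_succ norm_zero_one _ hh n hf h0, flowRHS, poisson, poisson]
    ring

end Canonical

/-! ### Commuting flows -/

section Commute

variable {𝕜 : Type*} [RCLike 𝕜]

/-- `c` is the constant in the product formula for principal values in the second variable. -/
def IsProductConstant (c : 𝕜) : Prop :=
  ∀ u v : ℝ × ℝ → 𝕜, IsSchwartz u → IsSchwartz v → ∀ z,
    lineHilbert (0, 1) u z * lineHilbert (0, 1) v z =
      lineHilbert (0, 1) (fun z => u z * lineHilbert (0, 1) v z) z
        + lineHilbert (0, 1) (fun z => v z * lineHilbert (0, 1) u z) z + c * (u z * v z)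

variable {c : 𝕜} (hc : IsProductConstant c)

include hc in
-- The product formula is applied to the pairs (u_p, v_x) and (u_x, v_p) and the results are
-- subtracted; P commutes with both partial derivatives.
theorem lineHilbert_poisson_add_poisson {u v : ℝ × ℝ → 𝕜} (hu : IsSchwartz u)
    (hv : IsSchwartz v) (z : ℝ × ℝ) :
    lineHilbert (0, 1) (fun z => poisson (lineHilbert (0, 1) u) v z +
      poisson u (lineHilbert (0, 1) v) z) z =
      poisson (lineHilbert (0, 1) u) (lineHilbert (0, 1) v) z - c * poisson u v z := by
  have hd : ∀ {u : ℝ × ℝ → 𝕜}, IsSchwartz u → ∀ z d, fderiv ℝ (lineHilbert (0, 1) u) z d =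
      lineHilbert (0, 1) (fun z => fderiv ℝ u z d) z := fun hu z d =>
    fderiv_lineHilbert_apply norm_zero_one hu z d
  have h1 := hc _ _ (hu.fderiv_apply (0, 1)) (hv.fderiv_apply (1, 0)) z
  have h2 := hc _ _ (hu.fderiv_apply (1, 0)) (hv.fderiv_apply (0, 1)) z
  have hm : ∀ {u v : ℝ × ℝ → 𝕜}, IsSchwartz u → IsSchwartz v →
      IsSchwartz (fun z => u z * lineHilbert (0, 1) v z) := fun hu hv =>
    hu.mul_right (hv.lineHilbert norm_zero_one)
  have e : (fun z => poisson (lineHilbert (0, 1) u) v z + poisson u (lineHilbert (0, 1) v) z) =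
      fun z => ((fderiv ℝ u z (0, 1) * lineHilbert (0, 1) (fun z => fderiv ℝ v z (1, 0)) z +
          fderiv ℝ v z (1, 0) * lineHilbert (0, 1) (fun z => fderiv ℝ u z (0, 1)) z) -
        (fderiv ℝ u z (1, 0) * lineHilbert (0, 1) (fun z => fderiv ℝ v z (0, 1)) z +
          fderiv ℝ v z (0, 1) * lineHilbert (0, 1) (fun z => fderiv ℝ u z (1, 0)) z)) := by
    ext z
    simp only [poisson, hd hu, hd hv]
    ring
  have u1 := hu.fderiv_apply (0, 1)
  have u2 := hu.fderiv_apply (1, 0)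
  have v1 := hv.fderiv_apply (0, 1)
  have v2 := hv.fderiv_apply (1, 0)
  rw [e, lineHilbert_sub norm_zero_one ((hm u1 v2).add (hm v2 u1)) ((hm u2 v1).add (hm v1 u2)),
    lineHilbert_add norm_zero_one (hm u1 v2) (hm v2 u1),
    lineHilbert_add norm_zero_one (hm u2 v1) (hm v1 u2), poisson, poisson]
  simp only [hd hu, hd hv]
  linear_combination h2 - h1

variable {h : 𝕜 → 𝕜} (hh : ContDiff 𝕜 ∞ h) (h0 : h 0 = 0) (n : ℕ)
  {g : 𝕜 → 𝕜} (hg : ContDiff 𝕜 ∞ g) (g0 : g 0 = 0) (m : ℕ)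
  {f : ℝ × ℝ → 𝕜} (hf : IsSchwartz f)

include hh h0 hf in
theorem isSchwartz_flowRHS : IsSchwartz (flowRHS h n f) :=
  ((isSchwartz_poisson (lineLam_hasTemperateGrowth norm_zero_one _ hf) hf).mul_left
    (density_hasTemperateGrowth norm_zero_one _ (contDiff_deriv hh) n hf)).sub
    (isSchwartz_poisson
      ((isSchwartz_density norm_zero_one _ hh n hf h0).lineHilbert norm_zero_one) hf)

include hc hh h0 hf in
/-- The evolution of `λ`. -/
theorem lineHilbert_flowRHS (z : ℝ × ℝ) :
    lineHilbert (0, 1) (flowRHS h n f) z =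
      c * (densityLam (0, 1) (.snd ℝ ℝ ℝ) h n f z * poisson (lineLam (0, 1) (.snd ℝ ℝ ℝ) f) f z)
      - poisson (lineHilbert (0, 1) (density (0, 1) (.snd ℝ ℝ ℝ) h n f))
          (lineLam (0, 1) (.snd ℝ ℝ ℝ) f) z := by
  have ha : IsSchwartz (density (0, 1) (.snd ℝ ℝ ℝ) h n f) :=
    isSchwartz_density norm_zero_one _ hh n hf h0
  have key := lineHilbert_poisson_add_poisson hc ha hf z
  have hfl := isSchwartz_flowRHS hh h0 n hf
  -- Here Pf = λ - p. Since {a,λ} = α{f,λ} and {a,p} = -a_x, the sum of the two brackets is a_x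
  -- minus the flow.
  have e : (fun z => poisson (lineHilbert (0, 1) (density (0, 1) (.snd ℝ ℝ ℝ) h n f)) f z +
      poisson (density (0, 1) (.snd ℝ ℝ ℝ) h n f) (lineHilbert (0, 1) f) z) =
      fun z => fderiv ℝ (density (0, 1) (.snd ℝ ℝ ℝ) h n f) z (1, 0) - flowRHS h n f z := by
    ext z
    simp only [flowRHS, poisson, fderiv_density norm_zero_one _ hh n hf,
      fderiv_lineHilbert_apply norm_zero_one hf, fderiv_lineLam norm_zero_one _ hf,
      ContinuousLinearMap.coe_snd', RCLike.ofReal_one, RCLike.ofReal_zero]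
    ring
  rw [e, lineHilbert_sub norm_zero_one (ha.fderiv_apply _) hfl,
    ← fderiv_lineHilbert_apply norm_zero_one ha] at key
  simp only [poisson, fderiv_density norm_zero_one _ hh n hf,
    fderiv_lineHilbert_apply norm_zero_one hf, fderiv_lineLam norm_zero_one _ hf,
      ContinuousLinearMap.coe_snd', RCLike.ofReal_one, RCLike.ofReal_zero] at key ⊢
  linear_combination -key

/-- The variation of the density `h(f) λ^n / n!` along `Φ`. -/
def densityVar (h : 𝕜 → 𝕜) (n : ℕ) (f Φ : ℝ × ℝ → 𝕜) (z : ℝ × ℝ) : 𝕜 :=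
  density (0, 1) (.snd ℝ ℝ ℝ) (deriv h) n f z * Φ z +
    densityLam (0, 1) (.snd ℝ ℝ ℝ) h n f z * lineHilbert (0, 1) Φ z

include hh h0 hf in
theorem isSchwartz_densityVar {Φ : ℝ × ℝ → 𝕜} (hΦ : IsSchwartz Φ) :
    IsSchwartz (densityVar h n f Φ) :=
  (hΦ.mul_left (density_hasTemperateGrowth norm_zero_one _ (contDiff_deriv hh) n hf)).add
    ((isSchwartz_densityLam norm_zero_one _ hh n hf h0).mul_right (hΦ.lineHilbert norm_zero_one))

/-- The variation of `flowRHS h n f` along `Φ`. -/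
def flowVar (h : 𝕜 → 𝕜) (n : ℕ) (f Φ : ℝ × ℝ → 𝕜) (z : ℝ × ℝ) : 𝕜 :=
  densityVar (deriv h) n f Φ z * poisson (lineLam (0, 1) (.snd ℝ ℝ ℝ) f) f z
    + density (0, 1) (.snd ℝ ℝ ℝ) (deriv h) n f z *
      (poisson (lineHilbert (0, 1) Φ) f z + poisson (lineLam (0, 1) (.snd ℝ ℝ ℝ) f) Φ z)
    - poisson (lineHilbert (0, 1) (densityVar h n f Φ)) f z
    - poisson (lineHilbert (0, 1) (density (0, 1) (.snd ℝ ℝ ℝ) h n f)) Φ z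

include hh h0 hf in
theorem hasDerivAt_flowRHS {Φ : ℝ × ℝ → 𝕜} (hΦ : IsSchwartz Φ) (z : ℝ × ℝ) :
    HasDerivAt (fun ε => flowRHS h n (fun z => f z + ε * Φ z) z) (flowVar h n f Φ z) 0 := by
  have hfε : ∀ ε : 𝕜, IsSchwartz (fun z => f z + ε * Φ z) := fun ε => hf.add (hΦ.const_mul ε)
  have a0 := hasDerivAt_density norm_zero_one (.snd ℝ ℝ ℝ) (contDiff_deriv hh) n hf hΦ 0 z
  have aff : ∀ a b : 𝕜, HasDerivAt (fun ε : 𝕜 => a + ε * b) b 0 := fun a b => by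
    simpa using ((hasDerivAt_id' (0 : 𝕜)).mul_const b).const_add a
  have df : ∀ d : ℝ × ℝ, HasDerivAt (fun ε : 𝕜 => fderiv ℝ (fun z => f z + ε * Φ z) z d)
      (fderiv ℝ Φ z d) 0 := fun d => by
    refine (aff (fderiv ℝ f z d) (fderiv ℝ Φ z d)).congr_of_eventuallyEq
      (Eventually.of_forall fun ε => ?_)
    have := ((hf.differentiable z).hasFDerivAt.fun_add
      ((hΦ.differentiable z).hasFDerivAt.const_mul ε)).fderiv
    simp [this]
  have dl : ∀ d : ℝ × ℝ, HasDerivAt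
      (fun ε : 𝕜 => fderiv ℝ (lineLam (0, 1) (.snd ℝ ℝ ℝ) (fun z => f z + ε * Φ z)) z d)
      (fderiv ℝ (lineHilbert (0, 1) Φ) z d) 0 := fun d => by
    refine (aff (fderiv ℝ (lineLam (0, 1) (.snd ℝ ℝ ℝ) f) z d) _).congr_of_eventuallyEq
      (Eventually.of_forall fun ε => ?_)
    have h2 := (((lineLam_hasTemperateGrowth norm_zero_one (.snd ℝ ℝ ℝ) hf).hasFDerivAt z).fun_add
      (((hΦ.lineHilbert norm_zero_one).hasFDerivAt z).const_mul ε)).fderiv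
    have e : lineLam (0, 1) (.snd ℝ ℝ ℝ) (fun z => f z + ε * Φ z) = fun z =>
        lineLam (0, 1) (.snd ℝ ℝ ℝ) f z + ε * lineHilbert (0, 1) Φ z :=
      funext fun z => lineLam_add_mul (.snd ℝ ℝ ℝ) norm_zero_one hf hΦ ε z
    simp [e, h2]
  have dP : ∀ d : ℝ × ℝ, HasDerivAt (fun ε : 𝕜 => fderiv ℝ (lineHilbert (0, 1)
      (density (0, 1) (.snd ℝ ℝ ℝ) h n (fun z => f z + ε * Φ z))) z d)
      (fderiv ℝ (lineHilbert (0, 1) (densityVar h n f Φ)) z d) 0 := fun d => by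
    -- The z-derivative is taken inside P first, so that the ε-derivative is that of the principal
    -- value of a Schwartz curve.
    have h1 := ((isSchwartzCurve_density norm_zero_one (.snd ℝ ℝ ℝ) hh n hf hΦ h0).fderiv_apply
      d).hasDerivAt_lineHilbert norm_zero_one z
    rw [fderiv_lineHilbert_apply norm_zero_one (isSchwartz_densityVar hh h0 n hf hΦ)]
    simp only [zero_mul, add_zero] at h1
    refine h1.congr_of_eventuallyEq (Eventually.of_forall fun ε => ?_)
    exact fderiv_lineHilbert_apply norm_zero_one
      (isSchwartz_density norm_zero_one _ hh n (hfε ε) h0) z d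
  have hJ := ((dl (0, 1)).fun_mul (df (1, 0))).fun_sub ((dl (1, 0)).fun_mul (df (0, 1)))
  have hB := ((dP (0, 1)).fun_mul (df (1, 0))).fun_sub ((dP (1, 0)).fun_mul (df (0, 1)))
  refine ((a0.fun_mul hJ).fun_sub hB).congr_deriv ?_
  simp only [zero_mul, add_zero, flowVar, densityVar, poisson]
  ring

include hc hh hg g0 hf in
/-- The variation of the density along the other flow. -/
theorem densityVar_flowRHS (z : ℝ × ℝ) :
    densityVar h n f (flowRHS g m f) z =
      (density (0, 1) (.snd ℝ ℝ ℝ) (deriv h) n f z * density (0, 1) (.snd ℝ ℝ ℝ) (deriv g) m f z +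
        c * (densityLam (0, 1) (.snd ℝ ℝ ℝ) h n f z * densityLam (0, 1) (.snd ℝ ℝ ℝ) g m f z)) *
        poisson (lineLam (0, 1) (.snd ℝ ℝ ℝ) f) f z -
      poisson (lineHilbert (0, 1) (density (0, 1) (.snd ℝ ℝ ℝ) g m f))
        (density (0, 1) (.snd ℝ ℝ ℝ) h n f) z := by
  rw [densityVar, lineHilbert_flowRHS hc hg g0 m hf]
  -- With ∇a = α∇f + β∇λ, the brackets of Pb with f and with λ combine into {Pb, a}.
  simp only [flowRHS, poisson, fderiv_density norm_zero_one _ hh n hf]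
  ring

include hc hh h0 hg g0 hf in
-- In the difference of the crossed variations the term symmetric in the two flows cancels. What is
-- left is -({Pb,a} + {b,Pa}), exactly the combination on which P is known; {b,a} is then expanded
-- as a multiple of {λ,f}.
theorem lineHilbert_densityVar_sub (z : ℝ × ℝ) :
    lineHilbert (0, 1) (densityVar h n f (flowRHS g m f)) z -
      lineHilbert (0, 1) (densityVar g m f (flowRHS h n f)) z =
      poisson (lineHilbert (0, 1) (density (0, 1) (.snd ℝ ℝ ℝ) h n f))
        (lineHilbert (0, 1) (density (0, 1) (.snd ℝ ℝ ℝ) g m f)) z +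
      c * ((density (0, 1) (.snd ℝ ℝ ℝ) (deriv h) n f z * densityLam (0, 1) (.snd ℝ ℝ ℝ) g m f z -
        density (0, 1) (.snd ℝ ℝ ℝ) (deriv g) m f z * densityLam (0, 1) (.snd ℝ ℝ ℝ) h n f z) *
        poisson (lineLam (0, 1) (.snd ℝ ℝ ℝ) f) f z) := by
  have ha : IsSchwartz (density (0, 1) (.snd ℝ ℝ ℝ) h n f) :=
    isSchwartz_density norm_zero_one _ hh n hf h0
  have hb : IsSchwartz (density (0, 1) (.snd ℝ ℝ ℝ) g m f) :=
    isSchwartz_density norm_zero_one _ hg m hf g0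
  have key := lineHilbert_poisson_add_poisson hc hb ha z
  rw [← lineHilbert_sub norm_zero_one
    (isSchwartz_densityVar hh h0 n hf (isSchwartz_flowRHS hg g0 m hf))
    (isSchwartz_densityVar hg g0 m hf (isSchwartz_flowRHS hh h0 n hf))]
  have e : (fun z => densityVar h n f (flowRHS g m f) z - densityVar g m f (flowRHS h n f) z) =
      fun z => -(poisson (lineHilbert (0, 1) (density (0, 1) (.snd ℝ ℝ ℝ) g m f))
        (density (0, 1) (.snd ℝ ℝ ℝ) h n f) z + poisson (density (0, 1) (.snd ℝ ℝ ℝ) g m f)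
          (lineHilbert (0, 1) (density (0, 1) (.snd ℝ ℝ ℝ) h n f)) z) := by
    ext z
    rw [densityVar_flowRHS hc hh n hg g0 m hf, densityVar_flowRHS hc hg m hh h0 n hf,
      poisson_comm (density (0, 1) (.snd ℝ ℝ ℝ) g m f)]
    ring
  rw [e, lineHilbert_neg, key, poisson_comm (lineHilbert (0, 1) (density (0, 1) _ h n f))]
  simp only [poisson, fderiv_density norm_zero_one _ hh n hf,
    fderiv_density norm_zero_one _ hg m hf]
  ring

theorem fderiv_const_mul_apply' (a : 𝕜) {u : ℝ × ℝ → 𝕜} (hu : u.HasTemperateGrowth)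
    (z d : ℝ × ℝ) : fderiv ℝ (fun z => a * u z) z d = a * fderiv ℝ u z d := by
  rw [((hu.hasFDerivAt z).const_mul a).fderiv]
  simp

include hh h0 hf in
theorem fderiv_flowRHS (z d : ℝ × ℝ) : fderiv ℝ (flowRHS h n f) z d =
    density (0, 1) (.snd ℝ ℝ ℝ) (deriv h) n f z *
        fderiv ℝ (poisson (lineLam (0, 1) (.snd ℝ ℝ ℝ) f) f) z d +
      poisson (lineLam (0, 1) (.snd ℝ ℝ ℝ) f) f z *
        fderiv ℝ (density (0, 1) (.snd ℝ ℝ ℝ) (deriv h) n f) z d -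
      fderiv ℝ (poisson (lineHilbert (0, 1) (density (0, 1) (.snd ℝ ℝ ℝ) h n f)) f) z d := by
  have hα := density_hasTemperateGrowth norm_zero_one (.snd ℝ ℝ ℝ) (contDiff_deriv hh) n hf
  have hJ := poisson_hasTemperateGrowth
    (lineLam_hasTemperateGrowth norm_zero_one (.snd ℝ ℝ ℝ) hf) hf.hasTemperateGrowth
  have hP := poisson_hasTemperateGrowth ((isSchwartz_density norm_zero_one (.snd ℝ ℝ ℝ) hh n hf
    h0).lineHilbert norm_zero_one) hf.hasTemperateGrowth
  rw [show flowRHS h n f = fun z => density (0, 1) (.snd ℝ ℝ ℝ) (deriv h) n f z *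
    poisson (lineLam (0, 1) (.snd ℝ ℝ ℝ) f) f z -
    poisson (lineHilbert (0, 1) (density (0, 1) (.snd ℝ ℝ ℝ) h n f)) f z from rfl,
    fderiv_sub_apply' (hα.fun_mul hJ) hP, fderiv_mul_apply' hα hJ]

include hc hh h0 hf in
theorem fderiv_lineHilbert_flowRHS (z d : ℝ × ℝ) :
    fderiv ℝ (lineHilbert (0, 1) (flowRHS h n f)) z d =
    c * (densityLam (0, 1) (.snd ℝ ℝ ℝ) h n f z *
        fderiv ℝ (poisson (lineLam (0, 1) (.snd ℝ ℝ ℝ) f) f) z d +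
      poisson (lineLam (0, 1) (.snd ℝ ℝ ℝ) f) f z *
        fderiv ℝ (densityLam (0, 1) (.snd ℝ ℝ ℝ) h n f) z d) -
      fderiv ℝ (poisson (lineHilbert (0, 1) (density (0, 1) (.snd ℝ ℝ ℝ) h n f))
        (lineLam (0, 1) (.snd ℝ ℝ ℝ) f)) z d := by
  have hβ := densityLam_hasTemperateGrowth norm_zero_one (.snd ℝ ℝ ℝ) hh n hf
  have hL := lineLam_hasTemperateGrowth norm_zero_one (.snd ℝ ℝ ℝ) hf
  have hJ := poisson_hasTemperateGrowth hL hf.hasTemperateGrowth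
  have hP := poisson_hasTemperateGrowth ((isSchwartz_density norm_zero_one (.snd ℝ ℝ ℝ) hh n hf
    h0).lineHilbert norm_zero_one) hL
  rw [funext (lineHilbert_flowRHS hc hh h0 n hf),
    fderiv_sub_apply' ((Function.HasTemperateGrowth.const c).fun_mul (hβ.fun_mul hJ)) hP,
    fderiv_const_mul_apply' c (hβ.fun_mul hJ), fderiv_mul_apply' hβ hJ]

include hc hh h0 hg g0 hf in
theorem fderiv_lineHilbert_densityVar_sub (z d : ℝ × ℝ) :
    fderiv ℝ (lineHilbert (0, 1) (densityVar h n f (flowRHS g m f))) z d -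
      fderiv ℝ (lineHilbert (0, 1) (densityVar g m f (flowRHS h n f))) z d =
      fderiv ℝ (poisson (lineHilbert (0, 1) (density (0, 1) (.snd ℝ ℝ ℝ) h n f))
        (lineHilbert (0, 1) (density (0, 1) (.snd ℝ ℝ ℝ) g m f))) z d +
      c * ((density (0, 1) (.snd ℝ ℝ ℝ) (deriv h) n f z * densityLam (0, 1) (.snd ℝ ℝ ℝ) g m f z -
        density (0, 1) (.snd ℝ ℝ ℝ) (deriv g) m f z * densityLam (0, 1) (.snd ℝ ℝ ℝ) h n f z) *
        fderiv ℝ (poisson (lineLam (0, 1) (.snd ℝ ℝ ℝ) f) f) z d +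
        poisson (lineLam (0, 1) (.snd ℝ ℝ ℝ) f) f z *
        (density (0, 1) (.snd ℝ ℝ ℝ) (deriv h) n f z *
            fderiv ℝ (densityLam (0, 1) (.snd ℝ ℝ ℝ) g m f) z d +
          densityLam (0, 1) (.snd ℝ ℝ ℝ) g m f z *
            fderiv ℝ (density (0, 1) (.snd ℝ ℝ ℝ) (deriv h) n f) z d -
          (density (0, 1) (.snd ℝ ℝ ℝ) (deriv g) m f z *
            fderiv ℝ (densityLam (0, 1) (.snd ℝ ℝ ℝ) h n f) z d +
          densityLam (0, 1) (.snd ℝ ℝ ℝ) h n f z *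
            fderiv ℝ (density (0, 1) (.snd ℝ ℝ ℝ) (deriv g) m f) z d))) := by
  have ha := isSchwartz_density norm_zero_one (.snd ℝ ℝ ℝ) hh n hf h0
  have hb := isSchwartz_density norm_zero_one (.snd ℝ ℝ ℝ) hg m hf g0
  have hα := density_hasTemperateGrowth norm_zero_one (.snd ℝ ℝ ℝ) (contDiff_deriv hh) n hf
  have hα' := density_hasTemperateGrowth norm_zero_one (.snd ℝ ℝ ℝ) (contDiff_deriv hg) m hf
  have hβ := densityLam_hasTemperateGrowth norm_zero_one (.snd ℝ ℝ ℝ) hh n hf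
  have hβ' := densityLam_hasTemperateGrowth norm_zero_one (.snd ℝ ℝ ℝ) hg m hf
  have hJ := poisson_hasTemperateGrowth
    (lineLam_hasTemperateGrowth norm_zero_one (.snd ℝ ℝ ℝ) hf) hf.hasTemperateGrowth
  have hAB := poisson_hasTemperateGrowth (ha.lineHilbert norm_zero_one)
    (hb.lineHilbert norm_zero_one)
  have hW := (hα.fun_mul hβ').fun_sub (hα'.fun_mul hβ)
  rw [← fderiv_sub_apply' ((isSchwartz_densityVar hh h0 n hf
      (isSchwartz_flowRHS hg g0 m hf)).lineHilbert norm_zero_one)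
    ((isSchwartz_densityVar hg g0 m hf (isSchwartz_flowRHS hh h0 n hf)).lineHilbert norm_zero_one),
    funext (lineHilbert_densityVar_sub hc hh h0 n hg g0 m hf),
    fderiv_add_apply' hAB ((Function.HasTemperateGrowth.const c).fun_mul (hW.fun_mul hJ)),
    fderiv_const_mul_apply' c (hW.fun_mul hJ), fderiv_mul_apply' hW hJ,
    fderiv_sub_apply' (hα.fun_mul hβ') (hα'.fun_mul hβ), fderiv_mul_apply' hα hβ',
    fderiv_mul_apply' hα' hβ]

include hc hh h0 hg g0 hf in
/-- The flows commute. -/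
theorem flowVar_comm (z : ℝ × ℝ) :
    flowVar h n f (flowRHS g m f) z = flowVar g m f (flowRHS h n f) z := by
  have ha := (isSchwartz_density norm_zero_one (.snd ℝ ℝ ℝ) hh n hf h0).lineHilbert norm_zero_one
  have hb := (isSchwartz_density norm_zero_one (.snd ℝ ℝ ℝ) hg m hf g0).lineHilbert norm_zero_one
  have hL := lineLam_hasTemperateGrowth norm_zero_one (.snd ℝ ℝ ℝ) hf
  have hft := hf.hasTemperateGrowth
  -- These two identities eliminate the principal values of crossed variations, the only terms that
  -- are not expressed by derivatives of f, λ, Pa and Pb.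
  have d1 := fderiv_lineHilbert_densityVar_sub hc hh h0 n hg g0 m hf z (0, 1)
  have d2 := fderiv_lineHilbert_densityVar_sub hc hh h0 n hg g0 m hf z (1, 0)
  have s1 := fderiv_fderiv_comm ha z (1, 0) (0, 1)
  have s2 := fderiv_fderiv_comm hb z (1, 0) (0, 1)
  have s3 := fderiv_fderiv_comm hL z (1, 0) (0, 1)
  have s4 := fderiv_fderiv_comm hft z (1, 0) (0, 1)
  have p1 := lineHilbert_flowRHS hc hh h0 n hf z
  have p2 := lineHilbert_flowRHS hc hg g0 m hf z
  have q : ∀ (h : 𝕜 → 𝕜) (n : ℕ), flowRHS h n f z = density (0, 1) (.snd ℝ ℝ ℝ) (deriv h) n f z *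
    poisson (lineLam (0, 1) (.snd ℝ ℝ ℝ) f) f z -
    poisson (lineHilbert (0, 1) (density (0, 1) (.snd ℝ ℝ ℝ) h n f)) f z := fun _ _ => rfl
  unfold flowVar
  rw [densityVar, densityVar, p1, p2, q, q]
  simp only [show ∀ u v : ℝ × ℝ → 𝕜, poisson u v z = fderiv ℝ u z (0, 1) * fderiv ℝ v z (1, 0) -
    fderiv ℝ u z (1, 0) * fderiv ℝ v z (0, 1) from fun _ _ => rfl,
    fderiv_flowRHS hh h0 n hf, fderiv_flowRHS hg g0 m hf,
    fderiv_lineHilbert_flowRHS hc hh h0 n hf, fderiv_lineHilbert_flowRHS hc hg g0 m hf,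
    fderiv_poisson hL hft, fderiv_poisson ha hft, fderiv_poisson hb hft, fderiv_poisson ha hL,
    fderiv_poisson hb hL, fderiv_poisson ha hb,
    fderiv_density norm_zero_one _ (contDiff_deriv hh) n hf,
    fderiv_density norm_zero_one _ (contDiff_deriv hg) m hf, s1, s2, s3, s4] at d1 d2 ⊢
  -- The crossed variations enter through -{P(·), f}, so their p- and x-derivatives carry the
  -- weights -f_x and f_p.
  linear_combination (-fderiv ℝ f z (1, 0)) * d1 + fderiv ℝ f z (0, 1) * d2

end Commute

theorem commuteAt_flow {𝕜 : Type*} [RCLike 𝕜] {h : 𝕜 → 𝕜} (hh : ContDiff 𝕜 ∞ h) (h0 : h 0 = 0)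
    (n : ℕ) {g : 𝕜 → 𝕜} (hg : ContDiff 𝕜 ∞ g) (g0 : g 0 = 0) (m : ℕ) (f : 𝓢(ℝ × ℝ, 𝕜)) :
    CommuteAt (flow h n) (flow g m) f := by
  obtain ⟨c, hc⟩ := exists_lineHilbert_mul_lineHilbert_plane 𝕜
  have hf : IsSchwartz f := ⟨f, rfl⟩
  obtain ⟨a, ha⟩ := isSchwartz_flowRHS hh h0 n hf
  obtain ⟨b, hb⟩ := isSchwartz_flowRHS hg g0 m hf
  refine ⟨a, b, by rw [ha, flow_eq_flowRHS hh h0], by rw [hb, flow_eq_flowRHS hg g0], fun z =>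
    -- One value serves both derivatives; `flowVar_comm` identifies it with the variation in the
    -- other order.
    ⟨flowVar h n f b z, ?_, ?_⟩⟩
  · simp only [flow_eq_flowRHS hh h0]
    exact hasDerivAt_flowRHS hh h0 n hf ⟨b, rfl⟩ z
  · simp only [flow_eq_flowRHS hg g0]
    rw [hb, flowVar_comm hc hh h0 n hg g0 m hf, ← ha]
    exact hasDerivAt_flowRHS hg g0 m hf ⟨a, rfl⟩ z

end

end DKP

theorem mainTheorem4 {𝕜 : Type*} [RCLike 𝕜] (h : 𝕜 → 𝕜) (hh : ContDiff 𝕜 ∞ h) (h0 : h 0 = 0)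
    (n : ℕ) :
    -- the functional `H_{h,n}`, its variational derivative, and the vector field `X_{h,n}`
    (∀ f : 𝓢(ℝ, 𝕜),
      Integrable (fun p => h (f p) * DKP.lam f p ^ n) ∧
      DKP.HasVarDensity (DKP.H h n) f (DKP.dH h n f) ∧
      ∀ p : ℝ, DKP.X h n f p =
        ((n : 𝕜) / (n ! : 𝕜) * DKP.pv (fun q => h (f q) * DKP.lam f q ^ (n - 1)) p
          - 1 / (n ! : 𝕜) * deriv h (f p) * DKP.lam f p ^ n) * deriv f p) ∧
    -- the recursion relation, an identity between tempered distributions in `q` for each `p`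
    (∀ (f : 𝓢(ℝ, 𝕜)) (p : ℝ), ∃ T : 𝓢(ℝ, 𝕜) →L[𝕜] 𝕜,
      DKP.HasCovDeriv (DKP.dH h (n + 1)) f p T ∧
      ∀ Φ : 𝓢(ℝ, 𝕜), T Φ = DKP.V h n f Φ p) ∧
    -- the flows are Hamiltonian
    (∀ f : 𝓢(ℝ × ℝ, 𝕜),
      Integrable (fun x => DKP.H h (n + 1) (DKP.slice f x)) ∧
      ∀ z : ℝ × ℝ,
        DKP.HasLPBracket f (fun g => g z) (DKP.totalH h (n + 1)) (DKP.flow h n f z)) ∧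
    -- the flows commute pairwise
    (∀ g : 𝕜 → 𝕜, ContDiff 𝕜 ∞ g → g 0 = 0 → ∀ (m : ℕ) (f : 𝓢(ℝ × ℝ, 𝕜)),
      DKP.CommuteAt (DKP.flow h n) (DKP.flow g m) f) := by
  refine ⟨fun f => ⟨DKP.integrable_comp_mul_lam_pow hh h0 n f, ?_, DKP.X_eq hh h0 n f⟩,
    fun f p => DKP.exists_hasCovDeriv hh h0 n f p,
    fun f => ⟨DKP.integrable_H_slice hh h0 (n + 1) f, fun z => DKP.hasLPBracket_flow hh h0 n f z⟩,
    fun g hg g0 m f => DKP.commuteAt_flow hh h0 n hg g0 m f⟩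
  rw [DKP.dH_eq_covector hh h0]
  exact DKP.hasVarDensity_H hh h0 n f
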